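/- Let $\mathrm{Irr}=(0,1)\setminus\mathbb{Q}$ and $\Sigma_\#=\{0,1,\#\}$. Let $R\subseteq\Sigma_\#^{\omega}$ be the set of infinite words $w=\#w_1\#w_2\#w_3\cdots$ in which every $w_i\in\{0,1\}^*$ contains at least one $1$. For such $w$ let $\alpha(w)\in\mathrm{Irr}$ be the number with continued fraction expansion $[0;a_1,a_2,\dots]$, where $a_i=\sum_j b_j2^j$ for $w_i=b_0b_1\cdots b_\ell$ (least significant digit first). Write $u\sim_\# v$ if the words $u$ and $v$ have the letter $\#$ at exactly the same positions. For $X\subseteq\mathrm{Irr}^k$ put $$X_R=\{(v_1,\dots,v_k)\in R^k : v_1\sim_\#\cdots\sim_\# v_k,\ (\alpha(v_1),\dots,\alpha(v_k))\in X\}.$$ A Büchi automaton $\mathcal A$ over the alphabet $\Sigma_\#^k$ recognizes $X$ modulo $\sim_\#$ if the infinite words over $\Sigma_\#^k$ that it accepts are exactly the convolutions (letter-by-letter tuples) of the elements of $X_R$. **Theorem.** Let $X_1\subseteq\mathrm{Irr}^{k_1},\dots,X_n\subseteq\mathrm{Irr}^{k_n}$ be recognized modulo $\sim_\#$ by Büchi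 automata $\mathcal A_1,\dots,\mathcal A_n$. Then the first-order theory (with equality) of the structure $(\mathrm{Irr};X_1,\dots,X_n)$ is decidable. Moreover, this is uniform in the automata: there is a single algorithm that, given such $k_1,\dots,k_n$ and $\mathcal A_1,\dots,\mathcal A_n$ and a first-order sentence $\varphi$ in the signature with $n$ relation symbols of arities $k_1,\dots,k_n$, decides whether $(\mathrm{Irr};X_1,\dots,X_n)\models\varphi$. -/

import Mathlib

open Filter Topology

/-! ### Büchi automata -/

/-- A Büchi automaton `(Q, Σ, Δ, I, F)` over the alphabet `A`, as finite data: the states are named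
`0, …, numStates - 1`, and the finite sets `Δ`, `I`, `F` are given by listing their elements. -/
structure BuchiAutomaton (A : Type) where
  /-- the number of states -/
  numStates : ℕ
  /-- the transition relation `Δ ⊆ Q × Σ × Q` -/
  trans : List (Fin numStates × A × Fin numStates)
  /-- the initial states -/
  init : List (Fin numStates)
  /-- the accept states -/
  accept : List (Fin numStates)

/-- The set of infinite words accepted by the automaton: those with a run that starts in an initial
state and visits accept states infinitely often. -/
def BuchiAutomaton.language {A : Type} (B : BuchiAutomaton A) : Set (ℕ → A) :=
  {σ | ∃ s : ℕ → Fin B.numStates, s 0 ∈ B.init ∧ (∀ n, (s n, σ n, s (n + 1)) ∈ B.trans) ∧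
    {n | s n ∈ B.accept}.Infinite}

/-- The alphabet `{0, 1, #}`: `none` is `#`, `some false` is `0` and `some true` is `1`. -/
abbrev HashSym : Type := Option Bool

/-- The convolution of a `k`-tuple of infinite words. -/
def convolution {k : ℕ} (u : Fin k → ℕ → HashSym) : ℕ → (Fin k → HashSym) := fun i j => u j i

/-- The automaton `B` recognizes the `k`-ary relation `W` on infinite words. -/
def BuchiAutomaton.Recognizes {k : ℕ} (B : BuchiAutomaton (Fin k → HashSym))
    (W : Set (Fin k → ℕ → HashSym)) : Prop :=
  B.language = convolution '' W

/-- Automata over `k`-tuples of symbols as inputs of an algorithm. -/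
abbrev AutomatonData : Type := ℕ × List (ℕ × List HashSym × ℕ) × List ℕ × List ℕ

/-- The automaton written out as a list of its components. -/
def BuchiAutomaton.data {k : ℕ} (B : BuchiAutomaton (Fin k → HashSym)) : AutomatonData :=
  (B.numStates, B.trans.map fun t => ((t.1 : ℕ), List.ofFn t.2.1, (t.2.2 : ℕ)),
    B.init.map fun q => (q : ℕ), B.accept.map fun q => (q : ℕ))

/-! ### `#`-binary codings of continued fractions -/

/-- `Irr = (0, 1) \ ℚ`. -/
def Irr : Set ℝ := {x | 0 < x ∧ x < 1 ∧ Irrational x}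

/-- The value `[b]₂ = ∑ bᵢ 2ⁱ` of a binary word, least significant digit first. -/
def binaryValue (b : List Bool) : ℕ := Nat.ofDigits 2 (b.map Bool.toNat)

/-- The infinite word `# b₀ # b₁ # b₂ ⋯`. Its `n`-th letter is read off from the finite prefix
`# b₀ # b₁ ⋯ # bₙ`, which has at least `n + 1` letters, so that the default value is never used. -/
def hashWord (b : ℕ → List Bool) (n : ℕ) : HashSym :=
  ((List.range (n + 1)).flatMap fun i => none :: (b i).map some).getD n none

/-- The continued fraction `[0; a₀, a₁, a₂, …]`. -/
noncomputable def contFrac (a : ℕ → ℕ) : GenContFract ℝ :=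
  ⟨0, Stream'.Seq.ofStream fun i => ⟨1, (a i : ℝ)⟩⟩

/-- `[0; a₀, a₁, a₂, …]` is the continued fraction expansion of `x`: all `aᵢ` are positive, and the
finite continued fractions `[0; a₀, …, aₖ]` converge to `x`. -/
def IsContFracExpansion (a : ℕ → ℕ) (x : ℝ) : Prop :=
  (∀ i, 0 < a i) ∧ Tendsto (contFrac a).convs' atTop (𝓝 x)

/-- `w` is a `#`-binary coding of the continued fraction of `x`. -/
def IsHashCoding (w : ℕ → HashSym) (x : ℝ) : Prop :=
  ∃ b : ℕ → List Bool, w = hashWord b ∧ IsContFracExpansion (fun i => binaryValue (b i)) x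

/-- The set `R` of words of the form `(#(0|1)*1(0|1)*)^ω`. -/
def hashR : Set (ℕ → HashSym) := {w | ∃ b : ℕ → List Bool, (∀ i, true ∈ b i) ∧ w = hashWord b}

/-- Two infinite words are aligned if they have `#` at the same positions. -/
def Aligned (u v : ℕ → HashSym) : Prop := ∀ i, u i = none ↔ v i = none

/-- The set `X_R` of the aligned tuples of words in `R` that code the tuples in `X`. -/
def alignedCodings {k : ℕ} (X : Set (Fin k → Irr)) : Set (Fin k → ℕ → HashSym) :=
  {v | (∀ i, v i ∈ hashR) ∧ (∀ i j, Aligned (v i) (v j)) ∧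
    ∃ x ∈ X, ∀ i, IsHashCoding (v i) (x i : ℝ)}

/-- `X ⊆ Irr^k` is recognizable modulo alignment by the automaton `B`. -/
def RecognizableBy {k : ℕ} (X : Set (Fin k → Irr)) (B : BuchiAutomaton (Fin k → HashSym)) : Prop :=
  B.Recognizes (alignedCodings X)

/-! ### First-order theories -/

/-- The relational signature with relation symbols `P₀, …, Pₙ₋₁`, where `Pᵢ` has arity `ar i`. -/
def relLang {n : ℕ} (ar : Fin n → ℕ) : FirstOrder.Language :=
  ⟨fun _ => Empty, fun k => {i : Fin n // ar i = k}⟩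

/-- The universe of the structure `(Irr; X₀, …, Xₙ₋₁)`. -/
def IrrStructure {n : ℕ} {ar : Fin n → ℕ} (_X : ∀ i, Set (Fin (ar i) → Irr)) : Type := Irr

/-- The structure `(Irr; X₀, …, Xₙ₋₁)`. -/
instance IrrStructure.structure {n : ℕ} {ar : Fin n → ℕ} (X : ∀ i, Set (Fin (ar i) → Irr)) :
    (relLang ar).Structure (IrrStructure X) where
  funMap f _ := Empty.elim f
  RelMap r x := (fun j => x (Fin.cast r.2 j)) ∈ X r.1

/-- The index of a bound variable; there are no other terms in sentences over `relLang ar`. -/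
def varIndex {n : ℕ} {ar : Fin n → ℕ} {m : ℕ} : (relLang ar).Term (Empty ⊕ Fin m) → ℕ
  | .var (.inl e) => Empty.elim e
  | .var (.inr j) => j
  | .func f _ => Empty.elim f

/-- Gödel numbers of formulas. -/
def godelNumber {n : ℕ} {ar : Fin n → ℕ} :
    {m : ℕ} → (relLang ar).BoundedFormula Empty m → ℕ
  | _, .falsum => Nat.pair 0 0
  | _, .equal s t => Nat.pair 1 (Nat.pair (varIndex s) (varIndex t))
  | _, .rel (r : {i : Fin n // ar i = _}) ts =>
      Nat.pair 2 (Nat.pair r.1 (Encodable.encode (List.ofFn fun j => varIndex (ts j))))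
  | _, .imp φ ψ => Nat.pair 3 (Nat.pair (godelNumber φ) (godelNumber ψ))
  | _, .all φ => Nat.pair 4 (godelNumber φ)

/-- The theory of `M` is decidable: an algorithm decides, given (the Gödel number of) a sentence,
whether it holds in `M`. -/
def HasDecidableTheory {n : ℕ} (ar : Fin n → ℕ) (M : Type) [(relLang ar).Structure M] : Prop :=
  ∃ f : ℕ → Bool, Computable f ∧
    ∀ φ : (relLang ar).Sentence, f (godelNumber φ) = true ↔ FirstOrder.Language.Sentence.Realize M φ

/-! ### Factors and infinite concatenations of words -/

/-! A formula with `m` free variables is translated into a language of words with `m` binary tracks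
and the common separator `#`, one block per partial quotient. Digits are written least significant
first, so zeros appended to a block do not change the values, and codings of finitely many numbers
can be brought to common block lengths. Every number in `Irr` has exactly one expansion
(`exists_expansion_of_irr`, `IsContFracExpansion.unique`), and every sequence of positive partial
quotients is the expansion of such a number (`exists_irr_of_pos`). Hence quantifying over `Irr`
amounts to quantifying over a new track on which every block contains a `1`, provided that the old
blocks may be lengthened by zeros. The substitution `padSub` does this by replacing `#` with a word
`z#` that is zero on the old tracks.

Languages are represented not by automata but by finite multiplication tables (`Saturates`). A
multiplicative map `H` sends nonempty words to a finite set; by Ramsey's theorem every infinite word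
has a factorization with constant prefix value `s` and constant factor value `e`, and the pair `(s,
e)` decides membership. Complementation just negates the acceptance table. Preimages under
set-valued substitutions are handled by the power set (`Saturates.pow`). This one construction
serves twice: for quantifiers, with `padSub`, and for the nondeterminism of Büchi automata, with the
substitution of a letter by its transitions.

By induction on the formula, `recognizes_evalRec` shows that on codings the language agrees with
truth, whichever coding is chosen. A sentence has no tracks, so it remains to test the single word
`#^ω`. The tables are lists of numbers, and each construction on them is primitive recursive; this
gives the uniform algorithm `decideTheory`. -/

section Words

variable {α β : Type*}

/-- The factor `x i, …, x (j - 1)` of an infinite word. -/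
def seg (x : ℕ → α) (i j : ℕ) : List α := (List.range' i (j - i)).map x

@[simp] lemma length_seg (x : ℕ → α) (i j : ℕ) : (seg x i j).length = j - i := by simp [seg]

lemma getElem_seg (x : ℕ → α) (i j n : ℕ) (h : n < (seg x i j).length) :
    (seg x i j)[n] = x (i + n) := by simp [seg]

lemma seg_succ (x : ℕ → α) (i : ℕ) : seg x i (i + 1) = [x i] := by simp [seg]

lemma seg_append (x : ℕ → α) {i j k : ℕ} (hij : i ≤ j) (hjk : j ≤ k) :
    seg x i j ++ seg x j k = seg x i k := by
  obtain ⟨a, rfl⟩ := Nat.exists_eq_add_of_le hij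
  obtain ⟨b, rfl⟩ := Nat.exists_eq_add_of_le hjk
  simp only [seg, ← List.map_append]
  congr 1
  rw [show i + a - i = a by omega, show i + a + b - (i + a) = b by omega,
    show i + a + b - i = a + b by omega]
  simp

lemma seg_succ_right (x : ℕ → α) {i j : ℕ} (hij : i ≤ j) :
    seg x i (j + 1) = seg x i j ++ [x j] := by
  rw [← seg_append x hij (Nat.le_succ j), seg_succ]

lemma seg_ne_nil (x : ℕ → α) {i j : ℕ} (h : i < j) : seg x i j ≠ [] := by
  intro h'
  have := congrArg List.length h'
  simp at this
  omega

lemma mem_seg {x : ℕ → α} {i j : ℕ} {a : α} : a ∈ seg x i j ↔ ∃ n, i ≤ n ∧ n < j ∧ x n = a := by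
  simp only [seg, List.mem_map, List.mem_range'_1]
  constructor
  · rintro ⟨n, hn, rfl⟩
    exact ⟨n, by omega, by omega, rfl⟩
  · rintro ⟨n, h1, h2, rfl⟩
    exact ⟨n, by omega, rfl⟩

/-- The length of the concatenation of the first `n` words. -/
def cut (p : ℕ → List α) (n : ℕ) : ℕ := (seg p 0 n).flatten.length

/-- The concatenation of infinitely many nonempty words. -/
def flat [Inhabited α] (p : ℕ → List α) (n : ℕ) : α := (seg p 0 (n + 1)).flatten.getD n default

@[simp] lemma cut_zero (p : ℕ → List α) : cut p 0 = 0 := by simp [cut, seg]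

lemma cut_succ (p : ℕ → List α) (n : ℕ) : cut p (n + 1) = cut p n + (p n).length := by
  simp [cut, seg_succ_right p (Nat.zero_le n)]

lemma strictMono_cut {p : ℕ → List α} (hp : ∀ n, p n ≠ []) : StrictMono (cut p) :=
  strictMono_nat_of_lt_succ fun n => by
    have := List.length_pos_of_ne_nil (hp n)
    rw [cut_succ]
    omega

variable [Inhabited α] [Inhabited β]

lemma seg_flat_zero {p : ℕ → List α} (hp : ∀ n, p n ≠ []) (N : ℕ) :
    seg (flat p) 0 (cut p N) = (seg p 0 N).flatten := by
  have pre : ∀ {a b : ℕ}, a ≤ b → (seg p 0 a).flatten <+: (seg p 0 b).flatten := fun {a b} h => by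
    rw [← seg_append p (Nat.zero_le a) h, List.flatten_append]
    exact List.prefix_append _ _
  refine List.ext_getElem (by simp [cut]) fun i h1 h2 => ?_
  rw [getElem_seg, Nat.zero_add]
  -- As no word is empty, the first `i + 1` words have total length at least `i + 1`, so the default
  -- value in `flat` is not used.
  have h3 : i < (seg p 0 (i + 1)).flatten.length := (strictMono_cut hp).id_le (i + 1)
  rw [flat, List.getD_eq_getElem _ _ h3]
  rcases le_total (i + 1) N with h | h
  · exact (pre h).getElem h3
  · exact ((pre h).getElem h2).symm

lemma seg_flat {p : ℕ → List α} (hp : ∀ n, p n ≠ []) {i j : ℕ} (hij : i ≤ j) :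
    seg (flat p) (cut p i) (cut p j) = (seg p i j).flatten := by
  have h := seg_append (flat p) (Nat.zero_le _) ((strictMono_cut hp).monotone hij)
  rw [seg_flat_zero hp, seg_flat_zero hp, ← seg_append p (Nat.zero_le i) hij,
    List.flatten_append] at h
  exact List.append_cancel_left h

/-- The cuts `K` start at `0` and are unbounded, so every position lies in the concatenation of
finitely many of the factors. -/
lemma eq_flat {p : ℕ → List α} {x : ℕ → α} {K : ℕ → ℕ} (hK : StrictMono K) (h0 : K 0 = 0)
    (h : ∀ n, seg x (K n) (K (n + 1)) = p n) : x = flat p := by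
  have key : ∀ N, seg x 0 (K N) = (seg p 0 N).flatten := by
    intro N
    induction N with
    | zero => simp [h0, seg]
    | succ N ih =>
      rw [← seg_append x (Nat.zero_le _) (hK.monotone (Nat.le_succ N)), ih, h,
        seg_succ_right p (Nat.zero_le N)]
      simp
  funext n
  have hn : n < K (n + 1) := hK.id_le (n + 1)
  rw [flat, ← key, List.getD_eq_getElem _ _ (by simpa using hn), getElem_seg, Nat.zero_add]

/-- Associativity of infinite concatenation: grouping the words first makes no difference. -/
lemma flat_flatten {q : ℕ → List (List α)} (hq : ∀ n, q n ≠ []) (hq' : ∀ n, ∀ l ∈ q n, l ≠ []) :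
    flat (fun i => (q i).flatten) = flat (flat q) := by
  have hf : ∀ n, flat q n ≠ [] := by
    intro n
    have hn : n < cut q (n + 1) := (strictMono_cut hq).id_le (n + 1)
    have : flat q n ∈ seg (flat q) 0 (cut q (n + 1)) := mem_seg.2 ⟨n, Nat.zero_le _, hn, rfl⟩
    rw [seg_flat_zero hq, List.mem_flatten] at this
    obtain ⟨l, hl, hl'⟩ := this
    obtain ⟨i, -, -, rfl⟩ := mem_seg.1 hl
    exact hq' i _ hl'
  refine (eq_flat (K := fun i => cut (flat q) (cut q i))
    ((strictMono_cut hf).comp (strictMono_cut hq)) (by simp) fun n => ?_).symm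
  rw [seg_flat hf ((strictMono_cut hq).monotone (Nat.le_succ n)), seg_flat hq (Nat.le_succ n),
    seg_succ]
  simp

lemma flat_rel {R : α → β → Prop} {u : ℕ → List α} {v : ℕ → List β} (hu : ∀ n, u n ≠ [])
    (h : ∀ n, List.Forall₂ R (u n) (v n)) (n : ℕ) : R (flat u n) (flat v n) := by
  have h1 : List.Forall₂ (List.Forall₂ R) (seg u 0 (n + 1)) (seg v 0 (n + 1)) := by
    simp only [seg, List.forall₂_map_left_iff, List.forall₂_map_right_iff, List.forall₂_same]
    exact fun i _ => h i
  have h2 := List.rel_flatten h1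
  have h3 : n < (seg u 0 (n + 1)).flatten.length := (strictMono_cut hu).id_le (n + 1)
  rw [flat, flat, List.getD_eq_getElem _ _ h3, List.getD_eq_getElem _ _ (h2.length_eq ▸ h3)]
  exact h2.get h3 (h2.length_eq ▸ h3)

end Words

/-! ### Substitutions -/

section Substitution

variable {α Γ : Type*}

/-- The images of a finite word under a set-valued substitution. -/
def wordSub (σ : α → Set (List Γ)) (w : List α) : Set (List Γ) :=
  {v | ∃ q : List (List Γ), List.Forall₂ (fun l a => l ∈ σ a) q w ∧ v = q.flatten}

/-- `y` is an image of the infinite word `x` under a set-valued substitution. -/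
def IsImage [Inhabited Γ] (σ : α → Set (List Γ)) (x : ℕ → α) (y : ℕ → Γ) : Prop :=
  ∃ p : ℕ → List Γ, (∀ n, p n ∈ σ (x n)) ∧ y = flat p

lemma mem_wordSub_append {σ : α → Set (List Γ)} {u w : List α} {v : List Γ} :
    v ∈ wordSub σ (u ++ w) ↔ ∃ v₁ ∈ wordSub σ u, ∃ v₂ ∈ wordSub σ w, v = v₁ ++ v₂ := by
  constructor
  · rintro ⟨q, hq, rfl⟩
    refine ⟨_, ⟨_, List.forall₂_take_append _ _ _ hq, rfl⟩, _,
      ⟨_, List.forall₂_drop_append _ _ _ hq, rfl⟩, ?_⟩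
    rw [← List.flatten_append, List.take_append_drop]
  · rintro ⟨_, ⟨q₁, h₁, rfl⟩, _, ⟨q₂, h₂, rfl⟩, rfl⟩
    exact ⟨q₁ ++ q₂, List.rel_append h₁ h₂, by simp⟩

lemma mem_wordSub_singleton {σ : α → Set (List Γ)} {a : α} {v : List Γ} :
    v ∈ wordSub σ [a] ↔ v ∈ σ a := by
  constructor
  · rintro ⟨q, hq, rfl⟩
    obtain ⟨l, q', hl, hq', rfl⟩ := List.forall₂_cons_right_iff.1 hq
    obtain rfl := List.forall₂_nil_right_iff.1 hq'
    simpa using hl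
  · exact fun h => ⟨[v], .cons h .nil, by simp⟩

lemma wordSub_ne_nil {σ : α → Set (List Γ)} (hσ : ∀ a, [] ∉ σ a) {w : List α} (hw : w ≠ [])
    {v : List Γ} (hv : v ∈ wordSub σ w) : v ≠ [] := by
  obtain ⟨q, hq, rfl⟩ := hv
  cases hq with
  | nil => exact absurd rfl hw
  | cons h t =>
    rename_i l _ _ _
    have : l ≠ [] := fun e => hσ _ (e ▸ h)
    simp [this]

lemma seg_flatten_mem_wordSub {σ : α → Set (List Γ)} {x : ℕ → α} {p : ℕ → List Γ}
    (hp : ∀ n, p n ∈ σ (x n)) (i j : ℕ) : (seg p i j).flatten ∈ wordSub σ (seg x i j) := by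
  refine ⟨_, ?_, rfl⟩
  simp only [seg, List.forall₂_map_left_iff, List.forall₂_map_right_iff, List.forall₂_same]
  exact fun n _ => hp n

/-- Images can be computed factor by factor: the images of the letters are regrouped along the cuts
of `u`, and conversely the finite lists of letter images are strung together. Both directions rest
on `flat_flatten`, hence on the nonemptiness of all images. -/
theorem isImage_flat_iff [Inhabited α] [Inhabited Γ] {σ : α → Set (List Γ)} (hσ : ∀ a, [] ∉ σ a)
    {u : ℕ → List α} (hu : ∀ i, u i ≠ []) {y : ℕ → Γ} :
    IsImage σ (flat u) y ↔ ∃ v, (∀ i, v i ∈ wordSub σ (u i)) ∧ y = flat v := by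
  have hmono := strictMono_cut hu
  constructor
  · rintro ⟨p, hp, rfl⟩
    have hp' : p = flat fun i => seg p (cut u i) (cut u (i + 1)) :=
      eq_flat hmono (cut_zero u) fun _ => rfl
    refine ⟨fun i => (seg p (cut u i) (cut u (i + 1))).flatten, fun i => ?_, ?_⟩
    · have := seg_flatten_mem_wordSub hp (cut u i) (cut u (i + 1))
      rwa [seg_flat hu (Nat.le_succ i), seg_succ, List.flatten_singleton] at this
    · rw [flat_flatten, ← hp']
      · exact fun i => seg_ne_nil _ (hmono (Nat.lt_succ_self i))
      · intro i l hl
        obtain ⟨n, -, -, rfl⟩ := mem_seg.1 hl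
        exact fun e => hσ _ (e ▸ hp n)
  · rintro ⟨v, hv, rfl⟩
    choose q hq hqv using hv
    have hq1 : ∀ i, q i ≠ [] := fun i hi => by
      have := (hq i).length_eq
      rw [hi] at this
      exact hu i (List.length_eq_zero_iff.1 this.symm)
    have hq2 : ∀ i, ∀ l ∈ q i, l ≠ [] := by
      intro i l hl h0
      obtain ⟨t, ht, ht'⟩ := List.getElem_of_mem hl
      have := (hq i).get ht ((hq i).length_eq ▸ ht)
      rw [show (q i).get ⟨t, ht⟩ = [] from ht'.trans h0] at this
      exact hσ _ this
    exact ⟨flat q, flat_rel (R := fun l a => l ∈ σ a) hq1 hq, by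
      rw [← flat_flatten hq1 hq2, ← funext hqv]⟩

end Substitution

/-! ### Ramsey factorizations -/

/-- Ramsey's theorem for pairs, by a nonprincipal ultrafilter. Each `i` has a colour `d i` with `col
i j = d i` for almost all `j`; almost all `i` share one `d i = e` and one label `g i = s`. -/
theorem exists_ramsey_subsequence (N : ℕ) (col : ℕ → ℕ → ℕ) (g : ℕ → ℕ)
    (hcol : ∀ i j, i < j → col i j < N) (hg : ∀ i, g i < N) :
    ∃ φ : ℕ → ℕ, StrictMono φ ∧ ∃ s e, (∀ i, g (φ i) = s) ∧
      ∀ i j, i < j → col (φ i) (φ j) = e := by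
  let U : Ultrafilter ℕ := hyperfilter ℕ
  have pig : ∀ f : ℕ → ℕ, (∀ᶠ j in (U : Filter ℕ), f j < N) →
      ∃ a, ∀ᶠ j in (U : Filter ℕ), f j = a := by
    intro f hf
    have h : ∀ᶠ j in (U : Filter ℕ), ∃ a ∈ Set.Iio N, f j = a := hf.mono fun j hj => ⟨_, hj, rfl⟩
    obtain ⟨a, -, ha⟩ := (Ultrafilter.eventually_exists_mem_iff (Set.finite_Iio N)).1 h
    exact ⟨a, ha⟩
  have gt : ∀ i, ∀ᶠ j in (U : Filter ℕ), i < j := fun i => by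
    have : ∀ᶠ j in (cofinite : Filter ℕ), i < j := by
      rw [Nat.cofinite_eq_atTop]
      exact eventually_gt_atTop i
    exact this.filter_mono hyperfilter_le_cofinite
  choose d hd using fun i => pig (col i) ((gt i).mono fun j hj => hcol i j hj)
  obtain ⟨s, hs⟩ := pig g (Eventually.of_forall hg)
  obtain ⟨e, he⟩ := pig d (by
    refine Eventually.of_forall fun i => ?_
    obtain ⟨j, h1, h2⟩ := ((hd i).and (gt i)).exists
    exact h1 ▸ hcol i j h2)
  -- Greedy choice: the next index has to satisfy finitely many conditions, each of which holds for
  -- almost all indices.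
  obtain ⟨φ, h1, h2⟩ := exists_seq_of_forall_finset_exists (fun i => g i = s ∧ d i = e)
    (fun i j => i < j ∧ col i j = e) (by
      intro t ht
      have h : ∀ᶠ j in (U : Filter ℕ), ∀ i ∈ t, i < j ∧ col i j = e := by
        rw [Filter.eventually_all_finset]
        intro i hi
        exact (gt i).and ((hd i).mono fun j hj => hj.trans (ht i hi).2)
      obtain ⟨j, ⟨h3, h4⟩, h5⟩ := ((hs.and he).and h).exists
      exact ⟨j, ⟨h3, h4⟩, h5⟩)
  exact ⟨φ, fun i j hij => (h2 i j hij).1, s, e, fun i => (h1 i).1, fun i j hij => (h2 i j hij).2⟩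

/-- The cuts `k` factorize `x` such that all prefixes have value `s` and all later factors have
value `e`. -/
structure IsFactorization {α : Type*} (H : List α → ℕ) (x : ℕ → α) (k : ℕ → ℕ) (s e : ℕ) : Prop where
  strictMono : StrictMono k
  pos : 0 < k 0
  init : ∀ i, H (seg x 0 (k i)) = s
  loop : ∀ i j, i < j → H (seg x (k i) (k j)) = e

/-- The multiplicative map `H` into a finite set with a multiplication saturates the language `L`,
where `acc s e` tells whether the words with a factorization of type `(s, e)` belong to `L`. -/
structure Saturates {α : Type*} (n : ℕ) (mul : ℕ → ℕ → ℕ) (acc : ℕ → ℕ → Bool) (H : List α → ℕ)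
    (L : Set (ℕ → α)) : Prop where
  lt : ∀ w, w ≠ [] → H w < n
  app : ∀ u v, u ≠ [] → v ≠ [] → H (u ++ v) = mul (H u) (H v)
  mem : ∀ x k s e, IsFactorization H x k s e → (x ∈ L ↔ acc s e = true)

section Saturates

variable {α Γ : Type*} {n : ℕ} {mul : ℕ → ℕ → ℕ} {acc : ℕ → ℕ → Bool} {H : List α → ℕ}
  {L : Set (ℕ → α)}

/-- The cuts are chosen among prescribed ones, so that a factorization of an image can be made
compatible with one of the original word. -/
theorem exists_factorization (hlt : ∀ w, w ≠ [] → H w < n) (x : ℕ → α) {c : ℕ → ℕ}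
    (hc : StrictMono c) (h0 : 0 < c 0) :
    ∃ φ s e, StrictMono φ ∧ IsFactorization H x (fun i => c (φ i)) s e := by
  obtain ⟨φ, hφ, s, e, hs, he⟩ := exists_ramsey_subsequence n
    (fun i j => H (seg x (c i) (c j))) (fun i => H (seg x 0 (c i)))
    (fun i j hij => hlt _ (seg_ne_nil x (hc hij)))
    (fun i => hlt _ (seg_ne_nil x (h0.trans_le (hc.monotone (Nat.zero_le i)))))
  exact ⟨φ, s, e, hφ, hc.comp hφ, h0.trans_le (hc.monotone (Nat.zero_le _)), hs, he⟩

/-- The prefixes up to two successive cuts have the same value, and the longer one is the shorter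
one times a factor. -/
lemma IsFactorization.mul_right (happ : ∀ u v, u ≠ [] → v ≠ [] → H (u ++ v) = mul (H u) (H v))
    {x : ℕ → α} {k : ℕ → ℕ} {s e : ℕ} (h : IsFactorization H x k s e) : mul s e = s := by
  have h01 : k 0 < k 1 := h.strictMono Nat.zero_lt_one
  have := happ _ _ (seg_ne_nil x h.pos) (seg_ne_nil x h01)
  rwa [seg_append x (Nat.zero_le _) h01.le, h.init, h.init, h.loop 0 1 Nat.zero_lt_one, eq_comm]
    at this

lemma IsFactorization.mul_self (happ : ∀ u v, u ≠ [] → v ≠ [] → H (u ++ v) = mul (H u) (H v))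
    {x : ℕ → α} {k : ℕ → ℕ} {s e : ℕ} (h : IsFactorization H x k s e) : mul e e = e := by
  have h01 : k 0 < k 1 := h.strictMono (by omega)
  have h12 : k 1 < k 2 := h.strictMono (by omega)
  have := happ _ _ (seg_ne_nil x h01) (seg_ne_nil x h12)
  rwa [seg_append x h01.le h12.le, h.loop 0 2 (by omega), h.loop 0 1 (by omega),
    h.loop 1 2 (by omega), eq_comm] at this

/-- Any factorization of a word decides its membership, so no determinization is needed. -/
theorem Saturates.compl (h : Saturates n mul acc H L) :
    Saturates n mul (fun s e => !acc s e) H Lᶜ :=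
  ⟨h.lt, h.app, fun x k s e hf => by simp [h.mem x k s e hf]⟩

/-- The set of the `i < n` with `p i`, as a bit mask. -/
def bitSet (n : ℕ) (p : ℕ → Bool) : ℕ := (List.range n).foldr (fun i t => 2 ^ i * (p i).toNat + t) 0

lemma bitSet_succ (n : ℕ) (p : ℕ → Bool) : bitSet (n + 1) p = 2 ^ n * (p n).toNat + bitSet n p := by
  have : ∀ (l : List ℕ) (c : ℕ), l.foldr (fun i t => 2 ^ i * (p i).toNat + t) c =
      c + l.foldr (fun i t => 2 ^ i * (p i).toNat + t) 0 := by
    intro l c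
    induction l with
    | nil => simp
    | cons a l ih => simp only [List.foldr_cons, ih]; ring
  rw [bitSet, List.range_succ, List.foldr_append, this]
  simp [bitSet]

lemma bitSet_lt (n : ℕ) (p : ℕ → Bool) : bitSet n p < 2 ^ n := by
  induction n with
  | zero => simp [bitSet]
  | succ n ih =>
    rw [bitSet_succ, pow_succ]
    cases p n <;> simp <;> omega

lemma testBit_bitSet (n : ℕ) (p : ℕ → Bool) (i : ℕ) :
    (bitSet n p).testBit i = true ↔ i < n ∧ p i = true := by
  induction n with
  | zero => simp [bitSet]
  | succ n ih =>
    rw [bitSet_succ, Nat.testBit_two_pow_mul_add _ (bitSet_lt n p)]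
    split_ifs with h
    · rw [ih]
      exact ⟨fun h' => ⟨by omega, h'.2⟩, fun h' => ⟨h, h'.2⟩⟩
    · rcases eq_or_ne i n with rfl | hne
      · simp [Nat.testBit_zero]
        cases p i <;> simp
      · have : ¬ i < n + 1 := by omega
        simp only [this, false_and, iff_false]
        rw [Nat.testBit_lt_two_pow (x := (p n).toNat)]
        · simp
        · exact (Bool.toNat_lt _).trans_le (by
            calc 2 = 2 ^ 1 := rfl
              _ ≤ _ := Nat.pow_le_pow_right (by omega) (by omega))

lemma bitSet_congr {n : ℕ} {p q : ℕ → Bool} (h : ∀ i < n, p i = q i) : bitSet n p = bitSet n q := by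
  induction n with
  | zero => simp [bitSet]
  | succ n ih => rw [bitSet_succ, bitSet_succ, ih fun i hi => h i (by omega), h n (by omega)]

/-- The product of sets. -/
def powMul (n : ℕ) (mul : ℕ → ℕ → ℕ) (X Y : ℕ) : ℕ :=
  bitSet n fun c => (List.range n).any fun a => (List.range n).any fun b =>
    X.testBit a && Y.testBit b && mul a b == c

/-- The acceptance condition for the power construction. -/
def powAcc (n : ℕ) (mul : ℕ → ℕ → ℕ) (acc : ℕ → ℕ → Bool) (X Y : ℕ) : Bool :=
  (List.range n).any fun a => (List.range n).any fun b =>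
    X.testBit a && Y.testBit b && mul a b == a && mul b b == b && acc a b

open Classical in
/-- The set of values of the images of a word under a substitution. -/
noncomputable def powMap (n : ℕ) (H : List Γ → ℕ) (σ : α → Set (List Γ)) (w : List α) : ℕ :=
  bitSet n fun c => decide (∃ v ∈ wordSub σ w, H v = c)

lemma testBit_powMap {n : ℕ} {H : List Γ → ℕ} {σ : α → Set (List Γ)} {w : List α} {c : ℕ} :
    (powMap n H σ w).testBit c = true ↔ c < n ∧ ∃ v ∈ wordSub σ w, H v = c := by
  simp [powMap, testBit_bitSet]

/-- A word is sent to the set of values of its images. Let `x` have a factorization with value sets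
`(A, E)`. An image in `L`, factorized by Ramsey along the images of the cuts, yields `s ∈ A` and `e
∈ E` with `s e = s`, `e e = e` and `acc s e`. Conversely, for such `s` and `e`, choose an image of
value `s` for the prefix and images of value `e` for the later factors; by the two equations their
concatenation has type `(s, e)`. -/
theorem Saturates.pow [Inhabited Γ] [Inhabited α] {H : List Γ → ℕ} {L : Set (ℕ → Γ)}
    (h : Saturates n mul acc H L) {σ : α → Set (List Γ)} (hσ : ∀ a, [] ∉ σ a) :
    Saturates (2 ^ n) (powMul n mul) (powAcc n mul acc) (powMap n H σ)
      {x | ∃ y, IsImage σ x y ∧ y ∈ L} := by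
  have hne : ∀ {w : List α}, w ≠ [] → ∀ {v}, v ∈ wordSub σ w → v ≠ [] :=
    fun hw v hv => wordSub_ne_nil hσ hw hv
  refine ⟨fun w _ => bitSet_lt _ _, fun u v hu hv => ?_, fun x k A E hf => ?_⟩
  · refine bitSet_congr fun c hc => ?_
    rw [Bool.eq_iff_iff]
    simp only [decide_eq_true_eq, List.any_eq_true, List.mem_range, Bool.and_eq_true, beq_iff_eq,
      testBit_powMap, mem_wordSub_append]
    constructor
    · rintro ⟨_, ⟨u', hu', v', hv', rfl⟩, rfl⟩
      exact ⟨H u', h.lt _ (hne hu hu'), H v', h.lt _ (hne hv hv'),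
        ⟨⟨h.lt _ (hne hu hu'), u', hu', rfl⟩, h.lt _ (hne hv hv'), v', hv', rfl⟩,
        (h.app _ _ (hne hu hu') (hne hv hv')).symm⟩
    · rintro ⟨_, -, _, -, ⟨⟨-, u', hu', rfl⟩, -, v', hv', rfl⟩, rfl⟩
      exact ⟨_, ⟨u', hu', v', hv', rfl⟩, h.app _ _ (hne hu hu') (hne hv hv')⟩
  · simp only [powAcc, List.any_eq_true, List.mem_range, Bool.and_eq_true, beq_iff_eq]
    constructor
    · rintro ⟨_, ⟨p, hp, rfl⟩, hy⟩
      have hp0 : ∀ m, p m ≠ [] := fun m e => hσ _ (e ▸ hp m)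
      have hcut := strictMono_cut hp0
      obtain ⟨φ, s, e, hφ, hfy⟩ := exists_factorization (c := fun i => cut p (k i)) h.lt (flat p)
        (hcut.comp hf.strictMono) (by simpa using hcut hf.pos)
      have hA : A.testBit s = true := by
        rw [← hf.init (φ 0), testBit_powMap, ← hfy.init 0, seg_flat_zero hp0]
        have hm := seg_flatten_mem_wordSub hp 0 (k (φ 0))
        exact ⟨h.lt _ (hne (seg_ne_nil x
          (hf.pos.trans_le (hf.strictMono.monotone (Nat.zero_le _)))) hm), _, hm, rfl⟩
      have hE : E.testBit e = true := by
        have h01 := hφ Nat.zero_lt_one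
        have h01' := hf.strictMono h01
        rw [← hf.loop _ _ h01, testBit_powMap, ← hfy.loop 0 1 Nat.zero_lt_one,
          seg_flat hp0 h01'.le]
        have hm := seg_flatten_mem_wordSub hp (k (φ 0)) (k (φ 1))
        exact ⟨h.lt _ (hne (seg_ne_nil x h01') hm), _, hm, rfl⟩
      have hs : s < n := by
        rw [← hfy.init 0]
        exact h.lt _ (seg_ne_nil _ hfy.pos)
      have he : e < n := by
        rw [← hfy.loop 0 1 Nat.zero_lt_one]
        exact h.lt _ (seg_ne_nil _ (hfy.strictMono Nat.zero_lt_one))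
      exact ⟨s, hs, e, he, ⟨⟨⟨hA, hE⟩, hfy.mul_right h.app⟩, hfy.mul_self h.app⟩,
        (h.mem _ _ _ _ hfy).1 hy⟩
    · rintro ⟨s, hs, e, he, ⟨⟨⟨hA, hE⟩, hse⟩, hee⟩, hacc⟩
      -- The cut `0` is put in front, so that the prefix becomes the factor with index `0`.
      let K : ℕ → ℕ := fun i => Nat.casesOn i 0 k
      have hK : StrictMono K := strictMono_nat_of_lt_succ fun i => by
        cases i with
        | zero => exact hf.pos
        | succ i => exact hf.strictMono (Nat.lt_succ_self i)
      have hx : x = flat fun i => seg x (K i) (K (i + 1)) := eq_flat hK rfl fun _ => rfl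
      have hu : ∀ i, seg x (K i) (K (i + 1)) ≠ [] := fun i => seg_ne_nil x (hK (Nat.lt_succ_self i))
      have hv : ∀ i, ∃ v ∈ wordSub σ (seg x (K i) (K (i + 1))), H v = if i = 0 then s else e := by
        intro i
        cases i with
        | zero =>
          rw [← hf.init 0, testBit_powMap] at hA
          exact hA.2
        | succ i =>
          rw [← hf.loop i (i + 1) (Nat.lt_succ_self i), testBit_powMap] at hE
          exact hE.2
      choose v hv hvH using hv
      have hp0 : ∀ i, v i ≠ [] := fun i => hne (hu i) (hv i)
      refine ⟨flat v, ?_, ?_⟩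
      · rw [hx]
        exact (isImage_flat_iff hσ hu).2 ⟨v, hv, rfl⟩
      · refine (h.mem _ (fun i => cut v (i + 1)) s e
          ⟨(strictMono_cut hp0).comp (strictMono_nat_of_lt_succ fun i => by omega), ?_, ?_, ?_⟩).2
          hacc
        · simpa using (strictMono_cut hp0) Nat.zero_lt_one
        · intro i
          rw [seg_flat_zero hp0]
          induction i with
          | zero => simp [seg_succ, hvH]
          | succ i ih =>
            rw [seg_succ_right _ (Nat.zero_le _), List.flatten_append, h.app, ih, ← hse]
            · simp [hvH, hse]
            · rw [← seg_flat_zero hp0]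
              exact seg_ne_nil _ (by simpa using strictMono_cut hp0 (Nat.succ_pos i))
            · simpa using hp0 (i + 1)
        · intro i j hij
          rw [seg_flat hp0 (by omega)]
          obtain ⟨j, rfl⟩ := Nat.exists_eq_add_of_lt hij
          clear hij
          induction j with
          | zero => simp [seg_succ, hvH]
          | succ j ih =>
            rw [show i + (j + 1) + 1 + 1 = (i + j + 1 + 1) + 1 by omega,
              seg_succ_right _ (by omega), List.flatten_append, h.app, ih, ← hee]
            · simp [hvH, hee]
            · rw [← seg_flat hp0 (by omega)]
              exact seg_ne_nil _ (strictMono_cut hp0 (by omega))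
            · simpa using hp0 _

end Saturates

/-! ### Recognizers as finite data -/

/-- A finite multiplication table with an acceptance table and the values of the letters. -/
abbrev Recognizer : Type := ℕ × List ℕ × List Bool × List ℕ

namespace Recognizer

/-- The number of elements. -/
def size (r : Recognizer) : ℕ := r.1

/-- The multiplication. -/
def mul (r : Recognizer) (a b : ℕ) : ℕ := r.2.1.getD (Nat.pair a b) 0

/-- The acceptance condition. -/
def acc (r : Recognizer) (a b : ℕ) : Bool := r.2.2.1.getD (Nat.pair a b) false

/-- The values of the letters. -/
def letter (r : Recognizer) (c : ℕ) : ℕ := r.2.2.2.getD c 0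

/-- The recognizer with the given operations, for `l` letters. -/
def mk (n : ℕ) (mul : ℕ → ℕ → ℕ) (acc : ℕ → ℕ → Bool) (l : ℕ) (letter : ℕ → ℕ) : Recognizer :=
  (n, (List.range (Nat.pair n n)).map fun i => mul i.unpair.1 i.unpair.2,
    (List.range (Nat.pair n n)).map fun i => acc i.unpair.1 i.unpair.2,
    (List.range l).map letter)

end Recognizer

lemma Nat.pair_lt_pair {a b c d : ℕ} (h₁ : a < c) (h₂ : b < d) : Nat.pair a b < Nat.pair c d :=
  (Nat.pair_lt_pair_left b h₁).trans (Nat.pair_lt_pair_right c h₂)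

namespace Recognizer

variable {n l : ℕ} {mul : ℕ → ℕ → ℕ} {acc : ℕ → ℕ → Bool} {letter : ℕ → ℕ}

/-- Monotonicity of pairing puts the index `Nat.pair a b` inside a table of length `Nat.pair n n`,
so the default value does not occur. -/
lemma mul_mk {a b : ℕ} (ha : a < n) (hb : b < n) : (mk n mul acc l letter).mul a b = mul a b := by
  have := Nat.pair_lt_pair ha hb
  simp [mk, Recognizer.mul, this]

lemma acc_mk {a b : ℕ} (ha : a < n) (hb : b < n) : (mk n mul acc l letter).acc a b = acc a b := by
  have := Nat.pair_lt_pair ha hb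
  simp [mk, Recognizer.acc, this]

lemma letter_mk {c : ℕ} (hc : c < l) : (mk n mul acc l letter).letter c = letter c := by
  simp [mk, Recognizer.letter, hc]

end Recognizer

/-- Only values below `n` occur, and only there do stored tables agree with the operations they
tabulate. -/
theorem Saturates.congr {α : Type*} {n : ℕ} {mul mul' : ℕ → ℕ → ℕ} {acc acc' : ℕ → ℕ → Bool}
    {H : List α → ℕ} {L : Set (ℕ → α)} (h : Saturates n mul acc H L)
    (hm : ∀ a < n, ∀ b < n, mul' a b = mul a b) (ha : ∀ a < n, ∀ b < n, acc' a b = acc a b) :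
    Saturates n mul' acc' H L := by
  refine ⟨h.lt, fun u v hu hv => ?_, fun x k s e hf => ?_⟩
  · rw [hm _ (h.lt u hu) _ (h.lt v hv), h.app u v hu hv]
  · have hs : s < n := hf.init 0 ▸ h.lt _ (seg_ne_nil _ hf.pos)
    have he : e < n := hf.loop 0 1 Nat.zero_lt_one ▸
      h.lt _ (seg_ne_nil _ (hf.strictMono Nat.zero_lt_one))
    rw [ha s hs e he, h.mem x k s e hf]

/-- The letters of words with `m` binary tracks: `none` is `#`. -/
abbrev Letter (m : ℕ) : Type := Option (Fin m → Bool)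

/-- Letters as numbers. -/
def Letter.code {m : ℕ} : Letter m → ℕ
  | none => 0
  | some f => Nat.ofBits f + 1

lemma Letter.code_lt {m : ℕ} (a : Letter m) : a.code < 2 ^ m + 1 := by
  cases a with
  | none => simp [code]
  | some f => simpa [code] using Nat.ofBits_lt_two_pow f

/-- The letter on track `j` of a letter given by its number. -/
def trackLetter (c j : ℕ) : HashSym := if c = 0 then none else some ((c - 1).testBit j)

lemma trackLetter_code {m : ℕ} (a : Letter m) (j : Fin m) :
    trackLetter a.code j = a.map fun f => f j := by
  cases a with
  | none => rfl
  | some f => simp [trackLetter, Letter.code]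

/-- `r` recognizes the language `L` of words with `m` tracks. -/
def Recognizer.Recognizes {m : ℕ} (r : Recognizer) (L : Set (ℕ → Letter m)) : Prop :=
  ∃ H : List (Letter m) → ℕ, Saturates r.size r.mul r.acc H L ∧ ∀ a, H [a] = r.letter a.code

theorem Saturates.recognizes_mk {m n : ℕ} {mul : ℕ → ℕ → ℕ} {acc : ℕ → ℕ → Bool}
    {letter : ℕ → ℕ} {H : List (Letter m) → ℕ} {L : Set (ℕ → Letter m)}
    (h : Saturates n mul acc H L) (hl : ∀ a, H [a] = letter a.code) :
    (Recognizer.mk n mul acc (2 ^ m + 1) letter).Recognizes L :=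
  ⟨H, h.congr (fun _ ha _ hb => Recognizer.mul_mk ha hb) (fun _ ha _ hb => Recognizer.acc_mk ha hb),
    fun a => by rw [hl, Recognizer.letter_mk a.code_lt]⟩

/-! ### Falsity and implication -/

/-- The recognizer of the empty language. -/
def falseRec (m : ℕ) : Recognizer :=
  Recognizer.mk 1 (fun _ _ => 0) (fun _ _ => false) (2 ^ m + 1) fun _ => 0

theorem recognizes_falseRec (m : ℕ) : (falseRec m).Recognizes (∅ : Set (ℕ → Letter m)) :=
  Saturates.recognizes_mk (H := fun _ => 0)
    ⟨fun _ _ => Nat.zero_lt_one, fun _ _ _ _ => rfl, fun _ _ _ _ _ => by simp⟩ fun _ => rfl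

/-- The recognizer of an implication, by the product construction. -/
def impRec (m : ℕ) (r s : Recognizer) : Recognizer :=
  Recognizer.mk (Nat.pair r.size s.size)
    (fun x y => Nat.pair (r.mul x.unpair.1 y.unpair.1) (s.mul x.unpair.2 y.unpair.2))
    (fun x y => !r.acc x.unpair.1 y.unpair.1 || s.acc x.unpair.2 y.unpair.2)
    (2 ^ m + 1) fun c => Nat.pair (r.letter c) (s.letter c)

/-- A factorization for the product map is, with the same cuts, a factorization for each component.
-/
theorem recognizes_impRec {m : ℕ} {r s : Recognizer} {L M : Set (ℕ → Letter m)}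
    (hr : r.Recognizes L) (hs : s.Recognizes M) :
    (impRec m r s).Recognizes {x | x ∈ L → x ∈ M} := by
  obtain ⟨H, hH, hHl⟩ := hr
  obtain ⟨G, hG, hGl⟩ := hs
  refine Saturates.recognizes_mk (H := fun w => Nat.pair (H w) (G w)) ⟨fun w hw =>
    Nat.pair_lt_pair (hH.lt w hw) (hG.lt w hw), fun u v hu hv => ?_, fun x k a e hf => ?_⟩ ?_
  · simp [hH.app u v hu hv, hG.app u v hu hv]
  · have h1 : IsFactorization H x k a.unpair.1 e.unpair.1 :=
      ⟨hf.strictMono, hf.pos, fun i => by rw [← hf.init i, Nat.unpair_pair],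
        fun i j hij => by rw [← hf.loop i j hij, Nat.unpair_pair]⟩
    have h2 : IsFactorization G x k a.unpair.2 e.unpair.2 :=
      ⟨hf.strictMono, hf.pos, fun i => by rw [← hf.init i, Nat.unpair_pair],
        fun i j hij => by rw [← hf.loop i j hij, Nat.unpair_pair]⟩
    rw [Set.mem_ofPred_eq, hH.mem _ _ _ _ h1, hG.mem _ _ _ _ h2]
    cases r.acc a.unpair.1 e.unpair.1 <;> simp
  · intro a
    rw [hHl, hGl]

/-! ### Quantification over a new track -/

/-- The closure of `{seed}` under multiplication by the elements of `z` from the left. -/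
def closeSet (n : ℕ) (mul : ℕ → ℕ → ℕ) (z : ℕ → Bool) (seed : ℕ) : ℕ :=
  bitSet n fun x => (List.range (2 ^ n)).all fun T =>
    !(T.testBit seed && (List.range n).all fun a => (List.range n).all fun t =>
      !(z a && T.testBit t) || T.testBit (mul a t)) || T.testBit x

/-- The elements `a₁ (a₂ (⋯ (aₖ seed)))` with `z aᵢ`. -/
inductive Generated (mul : ℕ → ℕ → ℕ) (z : ℕ → Bool) (seed : ℕ) : ℕ → Prop
  | base : Generated mul z seed seed
  | step {a t : ℕ} : z a = true → Generated mul z seed t → Generated mul z seed (mul a t)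

/-- `closeSet` intersects all masks `T < 2 ^ n` that contain the seed and are closed under the
multiplications. As the generated elements are below `n`, they form such a mask themselves, and it
is the least one. -/
theorem testBit_closeSet {n : ℕ} {mul : ℕ → ℕ → ℕ} {z : ℕ → Bool} {seed : ℕ}
    (hz : ∀ a, z a = true → a < n) (hlt : ∀ c, Generated mul z seed c → c < n) (c : ℕ) :
    (closeSet n mul z seed).testBit c = true ↔ Generated mul z seed c := by
  classical
  have key : ∀ T : ℕ, (!(T.testBit seed && (List.range n).all fun a => (List.range n).all fun t =>
      !(z a && T.testBit t) || T.testBit (mul a t)) || T.testBit c) = true ↔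
      (T.testBit seed = true → (∀ a < n, ∀ t < n, z a = true → T.testBit t = true →
        T.testBit (mul a t) = true) → T.testBit c = true) := by
    intro T
    rw [Bool.or_eq_true, Bool.not_eq_true', ← Bool.not_eq_true, Bool.and_eq_true]
    simp only [List.all_eq_true, List.mem_range, Bool.or_eq_true, Bool.not_eq_true',
      ← Bool.not_eq_true, Bool.and_eq_true]
    constructor
    · rintro (h | h) h1 h2
      · exact absurd ⟨h1, fun a ha t ht => or_iff_not_imp_left.2 fun h3 => by
          rw [not_not] at h3
          exact h2 a ha t ht h3.1 h3.2⟩ h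
      · exact h
    · intro h
      by_contra h'
      rw [not_or, not_not] at h'
      refine h'.2 (h h'.1.1 fun a ha t ht h3 h4 => ?_)
      exact (h'.1.2 a ha t ht).resolve_left fun h5 => h5 ⟨h3, h4⟩
  rw [closeSet, testBit_bitSet, List.all_eq_true]
  simp only [List.mem_range, key]
  constructor
  · rintro ⟨-, h⟩
    have hT : ∀ t, (bitSet n fun c => decide (Generated mul z seed c)).testBit t = true ↔
        Generated mul z seed t := fun t => by
      rw [testBit_bitSet, decide_eq_true_iff]
      exact ⟨fun h => h.2, fun h => ⟨hlt t h, h⟩⟩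
    have := h _ (bitSet_lt n fun c => decide (Generated mul z seed c))
    simp only [hT] at this
    exact this .base fun a _ t _ ha ht => .step ha ht
  · intro h
    refine ⟨hlt c h, fun T _ h1 h2 => ?_⟩
    clear key
    induction h with
    | base => exact h1
    | step ha ht ih => exact h2 _ (hz _ ha) _ (hlt _ ht) ha ih

/-- The letter `f` extended by the digit `b` on a new last track. -/
def extend {m : ℕ} (f : Fin m → Bool) (b : Bool) : Fin (m + 1) → Bool :=
  Fin.snoc (α := fun _ => Bool) f b

/-- The new track is the most significant bit, so a digit `1` on it adds `2 ^ m` to the code of a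
letter. -/
lemma ofBits_extend {m : ℕ} (f : Fin m → Bool) (b : Bool) :
    Nat.ofBits (extend f b) = Nat.ofBits f + b.toNat * 2 ^ m := by
  refine Nat.eq_of_testBit_eq fun i => ?_
  rw [show Nat.ofBits f + b.toNat * 2 ^ m = 2 ^ m * b.toNat + Nat.ofBits f by ring,
    Nat.testBit_two_pow_mul_add _ (Nat.ofBits_lt_two_pow f)]
  split_ifs with h
  · rw [Nat.testBit_ofBits_lt _ _ h, Nat.testBit_ofBits_lt _ _ (by omega)]
    exact Fin.snoc_castSucc (α := fun _ => Bool) b f ⟨i, h⟩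
  · rcases eq_or_ne i m with rfl | hne
    · rw [Nat.testBit_ofBits_lt _ _ (Nat.lt_succ_self i)]
      have : extend f b (Fin.last i) = b := Fin.snoc_last (α := fun _ => Bool) b f
      change extend f b (Fin.last i) = _
      rw [this]
      cases b <;> simp
    · rw [Nat.testBit_ofBits_ge _ _ (by omega), Nat.testBit_lt_two_pow]
      exact (Bool.toNat_lt _).trans_le (by
        calc 2 = 2 ^ 1 := rfl
          _ ≤ _ := Nat.pow_le_pow_right (by omega) (by omega))

/-- The substitution that adds a new last track, padding the blocks with zeros on the other tracks. -/
def padSub (m : ℕ) : Letter m → Set (List (Letter (m + 1)))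
  | none => {v | ∃ z : List Bool,
      v = z.map (fun b => some (extend (fun _ => false) b)) ++ [none]}
  | some f => {v | ∃ b, v = [some (extend f b)]}

lemma nil_notMem_padSub {m : ℕ} (a : Letter m) : [] ∉ padSub m a := by
  cases a with
  | none => rintro ⟨z, hz⟩; simp at hz
  | some f => rintro ⟨b, hb⟩; simp at hb

/-- The recognizer for universal quantification over a new track. -/
def allRec (m : ℕ) (r : Recognizer) : Recognizer :=
  Recognizer.mk (2 ^ r.size) (powMul r.size r.mul)
    (fun X Y => !powAcc r.size r.mul (fun a b => !r.acc a b) X Y) (2 ^ m + 1)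
    fun c => if c = 0 then
        closeSet r.size r.mul (fun a => a == r.letter 1 || a == r.letter (2 ^ m + 1)) (r.letter 0)
      else bitSet r.size fun a => a == r.letter c || a == r.letter (c + 2 ^ m)

/-- Universal quantification is complement, power construction, complement. What remains is to
compute the value sets of single letters. A letter of digits has two images; `#` has infinitely many
images `z#`, and their values are obtained from that of `#` by repeated left multiplication. -/
theorem recognizes_allRec {m : ℕ} {r : Recognizer} {L : Set (ℕ → Letter (m + 1))}
    (h : r.Recognizes L) :
    (allRec m r).Recognizes {x : ℕ → Letter m | ∀ y, IsImage (padSub m) x y → y ∈ L} := by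
  obtain ⟨H, hH, hHl⟩ := h
  have hp := (hH.compl.pow (σ := padSub m) nil_notMem_padSub).compl
  have hL : {x : ℕ → Letter m | ∃ y, IsImage (padSub m) x y ∧ y ∈ Lᶜ}ᶜ =
      {x | ∀ y, IsImage (padSub m) x y → y ∈ L} := by
    ext x
    simp
  rw [hL] at hp
  refine hp.recognizes_mk fun a => ?_
  have hlt : ∀ a : Letter (m + 1), H [a] < r.size := fun a => hH.lt _ (by simp)
  refine Nat.eq_of_testBit_eq fun c => ?_
  rw [Bool.eq_iff_iff, testBit_powMap]
  simp only [mem_wordSub_singleton]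
  have hext : ∀ (f : Fin m → Bool) (b : Bool), H [some (extend f b)] =
      r.letter (Nat.ofBits f + b.toNat * 2 ^ m + 1) := fun f b => by
    rw [hHl, Letter.code, ofBits_extend]
  cases a with
  | none =>
    -- Letters that vanish on the old tracks have code `1` or `2 ^ m + 1`, according to the digit on
    -- the new track.
    have h0 : Nat.ofBits (fun _ : Fin m => false) = 0 :=
      Nat.eq_of_testBit_eq fun i => by simp [Nat.testBit_ofBits]
    have e0 : H [none] = r.letter 0 := hHl none
    have e1 : H [some (extend (fun _ => false) false)] = r.letter 1 := by rw [hext, h0]; simp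
    have e2 : H [some (extend (fun _ => false) true)] = r.letter (2 ^ m + 1) := by
      rw [hext, h0]; simp
    have hz : ∀ a, (a == r.letter 1 || a == r.letter (2 ^ m + 1)) = true ↔
        ∃ b, a = H [some (extend (fun _ : Fin m => false) b)] := by
      intro a
      simp [e1, e2]
    have hg : ∀ c, Generated r.mul (fun a => a == r.letter 1 || a == r.letter (2 ^ m + 1))
        (r.letter 0) c ↔ ∃ v ∈ padSub m none, H v = c := by
      intro c
      constructor
      · intro hc
        induction hc with
        | base => exact ⟨[none], ⟨[], rfl⟩, e0⟩
        | step ha ht ih =>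
          obtain ⟨_, ⟨z, rfl⟩, rfl⟩ := ih
          obtain ⟨b, rfl⟩ := (hz _).1 ha
          refine ⟨_, ⟨b :: z, rfl⟩, ?_⟩
          rw [← hH.app _ _ (by simp) (by simp)]
          simp
      · rintro ⟨_, ⟨z, rfl⟩, rfl⟩
        induction z with
        | nil =>
          rw [List.map_nil, List.nil_append, e0]
          exact .base
        | cons b z ih =>
          rw [List.map_cons, List.cons_append, ← List.singleton_append,
            hH.app _ _ (by simp) (by simp)]
          exact .step ((hz _).2 ⟨b, rfl⟩) ih
    have hgl : ∀ c, Generated r.mul (fun a => a == r.letter 1 || a == r.letter (2 ^ m + 1))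
        (r.letter 0) c → c < r.size := by
      intro c hc
      obtain ⟨v, ⟨z, rfl⟩, rfl⟩ := (hg c).1 hc
      exact hH.lt _ (by simp)
    rw [if_pos (show Letter.code (none : Letter m) = 0 from rfl), testBit_closeSet _ hgl, hg]
    · exact ⟨fun h => h.2, fun h => ⟨hgl c ((hg c).2 h), h⟩⟩
    · intro a ha
      obtain ⟨b, rfl⟩ := (hz a).1 ha
      exact hlt _
  | some f =>
    rw [if_neg (by simp [Letter.code]), testBit_bitSet]
    refine and_congr_right fun _ => ?_
    have e1 : H [some (extend f false)] = r.letter (Letter.code (some f)) := by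
      rw [hext]; simp [Letter.code]
    have e2 : H [some (extend f true)] = r.letter (Letter.code (some f) + 2 ^ m) := by
      rw [hext]; simp only [Letter.code, Bool.toNat_true]; congr 1; ring
    simp only [padSub, Set.mem_ofPred_eq, Bool.or_eq_true, beq_iff_eq, ← e1, ← e2]
    constructor
    · rintro ⟨_, ⟨b, rfl⟩, rfl⟩
      cases b <;> simp
    · rintro (rfl | rfl)
      · exact ⟨_, ⟨false, rfl⟩, rfl⟩
      · exact ⟨_, ⟨true, rfl⟩, rfl⟩

/-- Whether the word `#^ω` belongs to a language of words without tracks. -/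
def acceptsHashes (r : Recognizer) : Bool :=
  powAcc r.size r.mul r.acc (closeSet r.size r.mul (fun a => a == r.letter 0) (r.letter 0))
    (closeSet r.size r.mul (fun a => a == r.letter 0) (r.letter 0))

/-- All nonempty factors of `#^ω` are powers of one letter, so their values are those generated by
the value of `#`. An accepted linked pair of such values is realized by cuts in arithmetic
progression, and Ramsey gives the converse. -/
theorem acceptsHashes_iff {r : Recognizer} {L : Set (ℕ → Letter 0)} (h : r.Recognizes L) :
    acceptsHashes r = true ↔ (fun _ => none) ∈ L := by
  obtain ⟨H, hH, hHl⟩ := h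
  have e0 : H [none] = r.letter 0 := hHl none
  have hseg : ∀ i j, seg (fun _ => (none : Letter 0)) i j = List.replicate (j - i) none := by
    intro i j
    refine List.eq_replicate_iff.2 ⟨length_seg _ _ _, fun a ha => ?_⟩
    obtain ⟨_, _, _, rfl⟩ := mem_seg.1 ha
    rfl
  have hg : ∀ c, Generated r.mul (fun a => a == r.letter 0) (r.letter 0) c ↔
      ∃ k, H (List.replicate (k + 1) none) = c := by
    intro c
    constructor
    · intro hc
      induction hc with
      | base => exact ⟨0, e0⟩
      | step ha ht ih =>
        obtain ⟨k, rfl⟩ := ih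
        rw [beq_iff_eq] at ha
        refine ⟨k + 1, ?_⟩
        rw [ha, ← e0, ← hH.app _ _ (by simp) (by simp), List.replicate_succ]
        rfl
    · rintro ⟨k, rfl⟩
      induction k with
      | zero => exact e0 ▸ .base
      | succ k ih =>
        rw [List.replicate_succ, ← List.singleton_append, hH.app _ _ (by simp) (by simp)]
        exact .step (by simp [e0]) ih
  have hcl := testBit_closeSet (n := r.size) (mul := r.mul) (z := fun a => a == r.letter 0)
    (seed := r.letter 0) (by simp only [beq_iff_eq, forall_eq, ← e0]; exact hH.lt _ (by simp))
    (fun c hc => by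
      obtain ⟨k, rfl⟩ := (hg c).1 hc
      exact hH.lt _ (by simp))
  simp only [acceptsHashes, powAcc, List.any_eq_true, List.mem_range, Bool.and_eq_true, beq_iff_eq,
    hcl, hg]
  constructor
  · rintro ⟨_, -, _, -, ⟨⟨⟨⟨a, rfl⟩, ⟨b, rfl⟩⟩, h1⟩, h2⟩, h3⟩
    have hrep : ∀ {i j : ℕ}, 0 < i → 0 < j → H (List.replicate (i + j) none) =
        r.mul (H (List.replicate i none)) (H (List.replicate j none)) := fun hi hj => by
      rw [List.replicate_add]
      exact hH.app _ _ (by simp; omega) (by simp; omega)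
    -- Idempotency of the loop value gives all its powers the same value.
    have hpow : ∀ d, H (List.replicate ((d + 1) * (b + 1)) none) =
        H (List.replicate (b + 1) none) := by
      intro d
      induction d with
      | zero => simp
      | succ d ih => rw [add_mul _ 1, one_mul, hrep (by positivity) (by omega), ih, h2]
    refine (hH.mem _ (fun i => (a + 1) + i * (b + 1)) _ _ ⟨?_, ?_, ?_, ?_⟩).2 h3
    · exact strictMono_nat_of_lt_succ fun i => by rw [add_mul]; omega
    · omega
    · intro i
      rw [hseg, Nat.sub_zero]
      cases i with
      | zero => simp
      | succ i => rw [hrep (by omega) (by positivity), hpow, h1]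
    · intro i j hij
      obtain ⟨d, rfl⟩ := Nat.exists_eq_add_of_lt hij
      rw [hseg, show a + 1 + (i + d + 1) * (b + 1) - (a + 1 + i * (b + 1)) = (d + 1) * (b + 1) by
        rw [show (i + d + 1) * (b + 1) = i * (b + 1) + (d + 1) * (b + 1) by ring]; omega, hpow]
  · intro hL
    obtain ⟨φ, s, e, hφ, hf⟩ := exists_factorization hH.lt (fun _ => (none : Letter 0))
      (c := fun i => i + 1) (fun _ _ h => Nat.succ_lt_succ h) (by simp)
    have h0 := hf.pos
    have h01 := hf.strictMono Nat.zero_lt_one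
    have hi := hf.init 0
    have hl := hf.loop 0 1 Nat.zero_lt_one
    rw [hseg] at hi hl
    refine ⟨s, hi ▸ hH.lt _ (by simp), e, hl ▸ hH.lt _ (by simp; omega),
      ⟨⟨⟨⟨_, hi⟩, ⟨φ 1 - φ 0 - 1, ?_⟩⟩, hf.mul_right hH.app⟩, hf.mul_self hH.app⟩,
      (hH.mem _ _ _ _ hf).1 hL⟩
    rw [← hl]
    congr 2
    change φ 0 + 1 < φ 1 + 1 at h01
    omega

/-! ### Büchi automata -/

/-- The code of the set of paths from state `p` to state `q`, where `f = 1` if the paths have to visit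
accept states; the code `0` stands for the absence of paths. -/
def pathCode (p f q : ℕ) : ℕ := Nat.pair p (Nat.pair f q) + 1

/-- The first state of a path. -/
def pathStart (x : ℕ) : ℕ := (x - 1).unpair.1

/-- Whether a path visits accept states. -/
def pathFlag (x : ℕ) : ℕ := (x - 1).unpair.2.unpair.1

/-- The last state of a path. -/
def pathEnd (x : ℕ) : ℕ := (x - 1).unpair.2.unpair.2

/-- The composition of paths. -/
def pathMul (x y : ℕ) : ℕ :=
  if x = 0 ∨ y = 0 ∨ pathEnd x ≠ pathStart y then 0
  else pathCode (pathStart x) (max (pathFlag x) (pathFlag y)) (pathEnd y)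

@[simp] lemma pathStart_pathCode (p f q : ℕ) : pathStart (pathCode p f q) = p := by
  simp [pathStart, pathCode]

@[simp] lemma pathFlag_pathCode (p f q : ℕ) : pathFlag (pathCode p f q) = f := by
  simp [pathFlag, pathCode]

@[simp] lemma pathEnd_pathCode (p f q : ℕ) : pathEnd (pathCode p f q) = q := by
  simp [pathEnd, pathCode]

@[simp] lemma pathCode_ne_zero (p f q : ℕ) : pathCode p f q ≠ 0 := Nat.succ_ne_zero _

/-- Needed to split the left fold in `runCode` at an arbitrary place. -/
lemma pathMul_assoc (x y z : ℕ) : pathMul (pathMul x y) z = pathMul x (pathMul y z) := by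
  by_cases h1 : x = 0 ∨ y = 0 ∨ pathEnd x ≠ pathStart y
  · rw [pathMul, pathMul, if_pos h1, if_pos (Or.inl rfl)]
    by_cases h2 : y = 0 ∨ z = 0 ∨ pathEnd y ≠ pathStart z
    · simp [pathMul, h2]
    · rw [pathMul, pathMul, if_neg h2, if_pos]
      simp only [not_or] at h2
      simpa [h2.1] using h1
  · have e1 : pathMul x y = _ := if_neg h1
    simp only [not_or, not_not] at h1
    by_cases h2 : y = 0 ∨ z = 0 ∨ pathEnd y ≠ pathStart z
    · have e2 : pathMul y z = 0 := if_pos h2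
      rw [e1, e2, pathMul, if_pos (by simpa [h1.2.1] using h2), pathMul, if_pos (by simp)]
    · have e2 : pathMul y z = _ := if_neg h2
      simp only [not_or, not_not] at h2
      rw [e1, e2, pathMul, if_neg (by simp [h2]), pathMul, if_neg (by simp [h1])]
      simp [max_assoc]

/-- A bound for the codes of paths between states up to `N`. -/
def pathBound (N : ℕ) : ℕ := Nat.pair (N + 1) (Nat.pair 2 (N + 1)) + 1

/-- A step of a run: the source, whether an accept state is visited, and the target. -/
abbrev RunStep (N : ℕ) : Type := Fin (N + 1) × Bool × Fin (N + 1)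

/-- The code of a step of a run. -/
def RunStep.code {N : ℕ} (d : RunStep N) : ℕ := pathCode d.1 d.2.1.toNat d.2.2

/-- The code of a finite sequence of steps. -/
def runCode {N : ℕ} : List (RunStep N) → ℕ
  | [] => 0
  | d :: l => l.foldl (fun t c => pathMul t (RunStep.code c)) (RunStep.code d)

lemma runCode_append {N : ℕ} (u v : List (RunStep N)) (hu : u ≠ []) (hv : v ≠ []) :
    runCode (u ++ v) = pathMul (runCode u) (runCode v) := by
  have key : ∀ (l : List (RunStep N)) (a b : ℕ),
      l.foldl (fun t c => pathMul t (RunStep.code c)) (pathMul a b) =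
        pathMul a (l.foldl (fun t c => pathMul t (RunStep.code c)) b) := by
    intro l
    induction l with
    | nil => simp
    | cons c l ih => intro a b; simp only [List.foldl_cons, pathMul_assoc, ih]
  cases u with
  | nil => exact absurd rfl hu
  | cons a u =>
    cases v with
    | nil => exact absurd rfl hv
    | cons b v => simp only [List.cons_append, runCode, List.foldl_append, List.foldl_cons, key]

lemma runCode_seg_succ {N : ℕ} (y : ℕ → RunStep N) {i j : ℕ} (h : i < j) :
    runCode (seg y i (j + 1)) = pathMul (runCode (seg y i j)) (y j).code := by
  rw [seg_succ_right y h.le, runCode_append _ _ (seg_ne_nil y h) (by simp)]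
  rfl

lemma runCode_lt {N : ℕ} (w : List (RunStep N)) (hw : w ≠ []) : runCode w < pathBound N := by
  have key : ∀ x : ℕ, (x = 0 ∨ ∃ p < N + 1, ∃ f < 2, ∃ q < N + 1, x = pathCode p f q) →
      x < pathBound N := by
    rintro x (rfl | ⟨p, hp, f, hf, q, hq, rfl⟩)
    · simp [pathBound]
    · exact Nat.succ_lt_succ (Nat.pair_lt_pair hp (Nat.pair_lt_pair hf hq))
  apply key
  have hc : ∀ d : RunStep N, ∃ p < N + 1, ∃ f < 2, ∃ q < N + 1, d.code = pathCode p f q :=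
    fun d => ⟨_, d.1.2, _, Bool.toNat_lt _, _, d.2.2.2, rfl⟩
  induction w using List.reverseRecOn with
  | nil => exact absurd rfl hw
  | append_singleton u d ih =>
    rcases eq_or_ne u [] with rfl | hu
    · exact Or.inr (hc d)
    · rw [runCode_append _ _ hu (by simp), show runCode [d] = d.code from rfl]
      rcases ih hu with h | ⟨p, hp, f, hf, q, hq, h⟩
      · exact Or.inl (by simp [h, pathMul])
      · obtain ⟨p', hp', f', hf', q', hq', h'⟩ := hc d
        rw [h, h', pathMul]
        split_ifs
        · exact Or.inl rfl
        · exact Or.inr ⟨p, hp, max f f', by omega, q', hq', by simp⟩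

/-- The code of a factor keeps all that matters for a run: whether consecutive steps fit together,
the two end states, and whether an accept state is visited. -/
lemma runCode_seg {N : ℕ} (y : ℕ → RunStep N) {i j : ℕ} (h : i < j) :
    ((∀ n, i ≤ n → n + 1 < j → (y n).2.2 = (y (n + 1)).1) ↔ runCode (seg y i j) ≠ 0) ∧
      (runCode (seg y i j) ≠ 0 → pathStart (runCode (seg y i j)) = (y i).1 ∧
        pathEnd (runCode (seg y i j)) = (y (j - 1)).2.2 ∧
        (pathFlag (runCode (seg y i j)) = 1 ↔ ∃ n, i ≤ n ∧ n < j ∧ (y n).2.1 = true) ∧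
        pathFlag (runCode (seg y i j)) < 2) := by
  obtain ⟨d, rfl⟩ := Nat.exists_eq_add_of_lt h
  clear h
  induction d with
  | zero =>
    have e : runCode (seg y i (i + 0 + 1)) = (y i).code := by
      rw [Nat.add_zero, seg_succ]
      rfl
    rw [e]
    refine ⟨⟨fun _ => pathCode_ne_zero _ _ _, fun _ n h1 h2 => by omega⟩, fun _ => ?_⟩
    have h1 : (∃ n, i ≤ n ∧ n < i + 0 + 1 ∧ (y n).2.1 = true) ↔ (y i).2.1 = true :=
      ⟨fun ⟨n, h1, h2, h3⟩ => by rwa [show i = n by omega], fun h => ⟨i, le_rfl, by omega, h⟩⟩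
    rw [h1]
    simp only [RunStep.code, pathStart_pathCode, pathEnd_pathCode, pathFlag_pathCode]
    refine ⟨trivial, rfl, ?_, Bool.toNat_lt _⟩
    cases (y i).2.1 <;> simp
  | succ d ih =>
    rw [show i + (d + 1) + 1 = (i + d + 1) + 1 by omega, runCode_seg_succ y (by omega)]
    generalize hX : runCode (seg y i (i + d + 1)) = X at ih
    obtain ⟨ih1, ih2⟩ := ih
    have hs : (∀ n, i ≤ n → n + 1 < i + d + 1 + 1 → (y n).2.2 = (y (n + 1)).1) ↔
        (∀ n, i ≤ n → n + 1 < i + d + 1 → (y n).2.2 = (y (n + 1)).1) ∧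
          (y (i + d)).2.2 = (y (i + d + 1)).1 := by
      refine ⟨fun h => ⟨fun n h1 h2 => h n h1 (by omega), h _ (by omega) (by omega)⟩,
        fun h n h1 h2 => ?_⟩
      rcases eq_or_ne n (i + d) with rfl | hne
      · exact h.2
      · exact h.1 n h1 (by omega)
    rw [hs, ih1, pathMul]
    by_cases hX0 : X = 0
    · simp [hX0]
    · obtain ⟨h1, h2, h3, h4⟩ := ih2 hX0
      have h2' : pathEnd X = (y (i + d)).2.2 := h2
      have hc : (X = 0 ∨ (y (i + d + 1)).code = 0 ∨ pathEnd X ≠ pathStart (y (i + d + 1)).code) ↔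
          ¬ (y (i + d)).2.2 = (y (i + d + 1)).1 := by
        simp [hX0, RunStep.code, h2', Fin.ext_iff]
      simp only [hc]
      by_cases he : (y (i + d)).2.2 = (y (i + d + 1)).1
      · rw [if_neg (not_not.2 he)]
        refine ⟨by simp [hX0, he], fun _ => ⟨by simp [h1], by simp [RunStep.code], ?_, ?_⟩⟩
        · have hsplit : (∃ n, i ≤ n ∧ n < i + d + 1 + 1 ∧ (y n).2.1 = true) ↔
              (∃ n, i ≤ n ∧ n < i + d + 1 ∧ (y n).2.1 = true) ∨ (y (i + d + 1)).2.1 = true := by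
            constructor
            · rintro ⟨n, h1, h2, h3⟩
              rcases eq_or_ne n (i + d + 1) with rfl | hne
              · exact Or.inr h3
              · exact Or.inl ⟨n, h1, by omega, h3⟩
            · rintro (⟨n, h1, h2, h3⟩ | h)
              · exact ⟨n, h1, by omega, h3⟩
              · exact ⟨_, by omega, by omega, h⟩
          rw [hsplit, ← h3]
          simp only [pathFlag_pathCode, RunStep.code]
          cases (y (i + d + 1)).2.1
          · simp
          · simp
            omega
        · simp only [pathFlag_pathCode, RunStep.code]
          have := Bool.toNat_lt (y (i + d + 1)).2.1
          omega
      · rw [if_pos he]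
        simp [he]

/-- The infinite sequences of consecutive steps that start in the given states and visit accept
states infinitely often. -/
def runLanguage (N : ℕ) (ini : ℕ → Bool) : Set (ℕ → RunStep N) :=
  {y | ini (y 0).1 = true ∧ (∀ n, (y n).2.2 = (y (n + 1)).1) ∧ ∀ n, ∃ k ≥ n, (y k).2.1 = true}

/-- The acceptance condition for sequences of steps. -/
def runAcc (ini : ℕ → Bool) (s e : ℕ) : Bool :=
  s != 0 && e != 0 && ini (pathStart s) && pathFlag e == 1

/-- Nonzero prefix values say that all steps fit together, and the start of `s` is the initial
state. All factors have the same flag, so accept states are visited infinitely often exactly if this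
flag is `1`. -/
theorem saturates_runLanguage (N : ℕ) (ini : ℕ → Bool) :
    Saturates (pathBound N) pathMul (runAcc ini) runCode (runLanguage N ini) := by
  refine ⟨runCode_lt, runCode_append, fun y k s e hf => ?_⟩
  have hk : ∀ n, n ≤ k n := hf.strictMono.id_le
  have hpos : ∀ i, 0 < k i := fun i => hf.pos.trans_le (hf.strictMono.monotone (Nat.zero_le i))
  have hlt : ∀ i, k i < k (i + 1) := fun i => hf.strictMono (Nat.lt_succ_self i)
  have H0 := fun i => runCode_seg y (hpos i)
  have H1 := fun i => runCode_seg y (hlt i)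
  simp only [hf.init] at H0
  simp only [hf.loop _ _ (Nat.lt_succ_self _)] at H1
  simp only [runAcc, Bool.and_eq_true, bne_iff_ne, beq_iff_eq]
  constructor
  · rintro ⟨h1, h2, h3⟩
    have hs : s ≠ 0 := (H0 0).1.1 fun n _ _ => h2 n
    have he : e ≠ 0 := (H1 0).1.1 fun n _ _ => h2 n
    refine ⟨⟨⟨hs, he⟩, by rwa [((H0 0).2 hs).1]⟩, ?_⟩
    -- A single accepting step after the first cut suffices: the factor that contains it ends at the
    -- first cut beyond `t`, and its value is `e`.
    obtain ⟨t, ht, ht'⟩ := h3 (k 0)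
    have hex : ∃ i, t < k i := ⟨t + 1, hk (t + 1)⟩
    have hi := Nat.find_spec hex
    have hmin := fun j => Nat.find_min hex (m := j)
    generalize Nat.find hex = i at hi hmin
    cases i with
    | zero => omega
    | succ i => exact ((H1 i).2 he).2.2.1.2 ⟨t, not_lt.1 (hmin i (Nat.lt_succ_self i)), hi, ht'⟩
  · rintro ⟨⟨⟨hs, he⟩, h1⟩, h2⟩
    refine ⟨by rwa [((H0 0).2 hs).1] at h1, fun n => ?_, fun n => ?_⟩
    · exact (H0 (n + 2)).1.2 hs n (Nat.zero_le n) (by have := hk (n + 2); omega)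
    · obtain ⟨t, h3, h4, h5⟩ := ((H1 n).2 he).2.2.1.1 h2
      exact ⟨t, (hk n).trans h3, h5⟩

/-- The recognizer of a Büchi automaton that reads the tracks `vs` of words with `m` tracks, where
the letter `#` is added in front. -/
def atomRec (A : AutomatonData) (vs : List ℕ) (m : ℕ) : Recognizer :=
  Recognizer.mk (2 ^ pathBound A.1) (powMul (pathBound A.1) pathMul)
    (powAcc (pathBound A.1) pathMul (runAcc fun q => A.2.1.any fun t =>
      t.2.2 == q && t.2.1 == vs.map (fun _ => (none : HashSym)) && A.2.2.1.any fun p => p == t.1))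
    (2 ^ m + 1) fun c => bitSet (pathBound A.1) fun d => A.2.1.any fun t =>
      t.2.1 == vs.map (trackLetter c) &&
        d == pathCode t.1 (A.2.2.2.any fun q => q == t.2.2).toNat t.2.2

/-- The infinite words on the tracks `v` of a word, with the letter `#` added in front. -/
def tracks {m k : ℕ} (v : Fin k → Fin m) (x : ℕ → Letter m) : ℕ → Fin k → HashSym
  | 0 => fun _ => none
  | n + 1 => fun j => (x n).map fun f => f (v j)

lemma flat_singleton {α : Type*} [Inhabited α] (y : ℕ → α) : flat (fun n => [y n]) = y :=
  (eq_flat strictMono_id rfl fun n => seg_succ y n).symm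

lemma BuchiAutomaton.data_init {k : ℕ} (B : BuchiAutomaton (Fin k → HashSym)) :
    B.data.2.2.1 = B.init.map Fin.val := by
  simp [BuchiAutomaton.data, List.map_eq_flatMap]

lemma BuchiAutomaton.data_accept {k : ℕ} (B : BuchiAutomaton (Fin k → HashSym)) :
    B.data.2.2.2 = B.accept.map Fin.val := by
  simp [BuchiAutomaton.data, List.map_eq_flatMap]

lemma BuchiAutomaton.mem_data_trans {k : ℕ} (B : BuchiAutomaton (Fin k → HashSym))
    {t : ℕ × List HashSym × ℕ} : t ∈ B.data.2.1 ↔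
      ∃ p f q, (p, f, q) ∈ B.trans ∧ t = ((p : ℕ), List.ofFn f, (q : ℕ)) := by
  simp [BuchiAutomaton.data, eq_comm]

/-- The automaton accepts a word if and only if some choice of a transition for each letter is an
accepting run. This is an image under a substitution, so `Saturates.pow` applies. The `#` in front
is absorbed into `ini`: a run starts in a state reached by `#` from an initial state. -/
theorem recognizes_atomRec {m k : ℕ} (B : BuchiAutomaton (Fin k → HashSym)) (v : Fin k → Fin m) :
    (atomRec B.data (List.ofFn fun j => (v j : ℕ)) m).Recognizes
      {x : ℕ → Letter m | tracks v x ∈ B.language} := by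
  classical
  let ltr : Letter m → Fin k → HashSym := fun a j => a.map fun f => f (v j)
  -- Steps live over `Fin (numStates + 1)`, which is inhabited even if there are no states. The flag
  -- is that of the target.
  let stp : Fin B.numStates → Fin B.numStates → RunStep B.numStates :=
    fun p q => (p.castSucc, decide (q ∈ B.accept), q.castSucc)
  let σ : Letter m → Set (List (RunStep B.numStates)) := fun a =>
    {l | ∃ p q, (p, ltr a, q) ∈ B.trans ∧ l = [stp p q]}
  have hσ : ∀ a, [] ∉ σ a := by
    rintro a ⟨p, q, -, h⟩
    simp at h
  let ini : ℕ → Bool := fun q => B.data.2.1.any fun t => t.2.2 == q &&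
    t.2.1 == (List.ofFn fun j => (v j : ℕ)).map (fun _ => (none : HashSym)) &&
      B.data.2.2.1.any fun p => p == t.1
  have hini : ∀ q : Fin B.numStates, ini q = true ↔
      ∃ p ∈ B.init, (p, (fun _ => none), q) ∈ B.trans := by
    intro q
    simp only [ini, B.data_init, List.any_eq_true, B.mem_data_trans, Bool.and_eq_true,
      beq_iff_eq, List.map_ofFn, List.mem_map]
    constructor
    · rintro ⟨_, ⟨p, f, q', ht, rfl⟩, ⟨hq, hf⟩, _, ⟨p', hp', rfl⟩, hp⟩
      obtain rfl := List.ofFn_injective hf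
      obtain rfl := Fin.ext hq
      obtain rfl := Fin.ext hp
      exact ⟨_, hp', ht⟩
    · rintro ⟨p, hp, ht⟩
      exact ⟨_, ⟨_, _, _, ht, rfl⟩, ⟨rfl, rfl⟩, _, ⟨p, hp, rfl⟩, rfl⟩
  have hmain := (saturates_runLanguage B.numStates ini).pow hσ
  have hL : {x | ∃ y, IsImage σ x y ∧ y ∈ runLanguage B.numStates ini} =
      {x : ℕ → Letter m | tracks v x ∈ B.language} := by
    ext x
    constructor
    · rintro ⟨_, ⟨p, hp, rfl⟩, h1, h2, h3⟩
      choose a b hab hp using hp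
      obtain rfl : p = fun n => [stp (a n) (b n)] := funext hp
      rw [flat_singleton] at h1 h2 h3
      obtain ⟨s, hs, hs'⟩ := (hini (a 0)).1 h1
      have hba : ∀ n, b n = a (n + 1) := fun n => Fin.castSucc_injective _ (h2 n)
      refine ⟨fun n => Nat.casesOn n s a, hs, fun n => ?_, ?_⟩
      · cases n with
        | zero => exact hs'
        | succ n =>
          have := hab n
          rw [hba] at this
          exact this
      · refine Set.infinite_of_forall_exists_gt fun n => ?_
        obtain ⟨t, ht, ht'⟩ := h3 n
        -- The run has one more state in front, and the flag of step `t` refers to its target, which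
        -- is state `t + 2` of the run.
        refine ⟨t + 2, ?_, by omega⟩
        have := of_decide_eq_true ht'
        rwa [hba] at this
    · rintro ⟨s, hs, hs', hs''⟩
      refine ⟨_, ⟨fun n => [stp (s (n + 1)) (s (n + 2))], fun n => ⟨_, _, hs' (n + 1), rfl⟩, rfl⟩, ?_⟩
      rw [flat_singleton]
      refine ⟨(hini _).2 ⟨_, hs, hs' 0⟩, fun n => rfl, fun n => ?_⟩
      obtain ⟨t, ht, ht'⟩ := hs''.exists_gt (n + 2)
      obtain ⟨t, rfl⟩ : ∃ d, t = d + 2 := ⟨t - 2, by omega⟩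
      exact ⟨t, by omega, decide_eq_true ht⟩
  rw [hL] at hmain
  refine hmain.recognizes_mk fun a => Nat.eq_of_testBit_eq fun c => ?_
  rw [Bool.eq_iff_iff, testBit_powMap, testBit_bitSet]
  refine and_congr_right fun _ => ?_
  have hacc : ∀ q : Fin B.numStates, (B.data.2.2.2.any fun p => p == (q : ℕ)) =
      decide (q ∈ B.accept) := by
    intro q
    rw [Bool.eq_iff_iff, B.data_accept]
    simp [Fin.val_inj]
  have hltr : (List.ofFn fun j => (v j : ℕ)).map (trackLetter a.code) = List.ofFn (ltr a) := by
    rw [List.map_ofFn]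
    exact congrArg List.ofFn (funext fun j => trackLetter_code a (v j))
  simp only [mem_wordSub_singleton, List.any_eq_true, B.mem_data_trans, Bool.and_eq_true,
    beq_iff_eq, hltr]
  constructor
  · rintro ⟨_, ⟨p, q, ht, rfl⟩, rfl⟩
    refine ⟨_, ⟨_, _, _, ht, rfl⟩, rfl, ?_⟩
    rw [hacc]
    rfl
  · rintro ⟨_, ⟨p, f, q, ht, rfl⟩, hf, rfl⟩
    obtain rfl := List.ofFn_injective hf
    refine ⟨_, ⟨p, q, ht, rfl⟩, ?_⟩
    rw [hacc]
    rfl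

/-! ### Continued fractions -/

/-- `[0; a₀, …, aₙ₋₂, aₙ₋₁ + t]`, and `t` for `n = 0`. -/
noncomputable def cfMap (a : ℕ → ℕ) : ℕ → ℝ → ℝ
  | 0, t => t
  | n + 1, t => 1 / ((a 0 : ℝ) + cfMap (fun i => a (i + 1)) n t)

lemma convs'_contFrac (a : ℕ → ℕ) (n : ℕ) : (contFrac a).convs' n = cfMap a n 0 := by
  have key : ∀ n (a : ℕ → ℕ), GenContFract.convs'Aux
      (Stream'.Seq.ofStream fun i => (⟨1, (a i : ℝ)⟩ : GenContFract.Pair ℝ)) n = cfMap a n 0 := by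
    intro n
    induction n with
    | zero => intro a; rfl
    | succ n ih =>
      intro a
      rw [cfMap, ← ih]
      rfl
  simp [GenContFract.convs', contFrac, key]

lemma cfMap_mem {a : ℕ → ℕ} (ha : ∀ i, 0 < a i) {t : ℝ} (ht : t ∈ Set.Icc (0 : ℝ) 1) (n : ℕ) :
    cfMap a n t ∈ Set.Icc (0 : ℝ) 1 := by
  induction n generalizing a with
  | zero => exact ht
  | succ n ih =>
    obtain ⟨h1, h2⟩ := ih (a := fun i => a (i + 1)) fun i => ha (i + 1)
    have h3 : (1 : ℝ) ≤ a 0 := by exact_mod_cast ha 0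
    rw [cfMap]
    exact ⟨by positivity, (div_le_one (by linarith)).2 (by linarith)⟩

lemma cfMap_add (a : ℕ → ℕ) (n j : ℕ) (t : ℝ) :
    cfMap a (n + j) t = cfMap a n (cfMap (fun i => a (i + n)) j t) := by
  induction n generalizing a with
  | zero => simp [cfMap]
  | succ n ih =>
    rw [show n + 1 + j = (n + j) + 1 by omega, cfMap, cfMap, ih]
    simp only [show ∀ i, i + (n + 1) = i + n + 1 by intro i; omega]

/-- One step need not contract by a fixed factor when the partial quotient is `1`, but two steps
contract by `1 / 4`: both denominators in the difference formula are at least `2`. Hence the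
induction by two and the constant `2`, which covers the case `n = 1`. -/
lemma abs_cfMap_sub_le {a : ℕ → ℕ} (ha : ∀ i, 0 < a i) {s t : ℝ} (hs : s ∈ Set.Icc (0 : ℝ) 1)
    (ht : t ∈ Set.Icc (0 : ℝ) 1) : ∀ n, |cfMap a n s - cfMap a n t| ≤ 2 * (1 / 2) ^ n
  | 0 => by
    rw [cfMap, cfMap, abs_le]
    constructor <;> linarith [hs.1, hs.2, ht.1, ht.2]
  | 1 => by
    have h1 := cfMap_mem ha hs 1
    have h2 := cfMap_mem ha ht 1
    rw [abs_le]
    constructor <;> linarith [h1.1, h1.2, h2.1, h2.2]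
  | n + 2 => by
    have ih := abs_cfMap_sub_le (a := fun i => a (i + 1 + 1)) (fun i => ha (i + 1 + 1)) hs ht n
    have hu := cfMap_mem (a := fun i => a (i + 1 + 1)) (fun i => ha (i + 1 + 1)) hs n
    have hv := cfMap_mem (a := fun i => a (i + 1 + 1)) (fun i => ha (i + 1 + 1)) ht n
    simp only [cfMap, zero_add]
    generalize cfMap (fun i => a (i + 1 + 1)) n s = u at *
    generalize cfMap (fun i => a (i + 1 + 1)) n t = v at *
    have h0 : (1 : ℝ) ≤ a 0 := by exact_mod_cast ha 0
    have h1 : (1 : ℝ) ≤ a 1 := by exact_mod_cast ha 1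
    generalize (a 0 : ℝ) = p at *
    generalize (a 1 : ℝ) = q at *
    have hu' : (0 : ℝ) < q + u := by linarith [hu.1]
    have hv' : (0 : ℝ) < q + v := by linarith [hv.1]
    have e : 1 / (p + 1 / (q + u)) - 1 / (p + 1 / (q + v)) =
        (u - v) / ((p * (q + u) + 1) * (p * (q + v) + 1)) := by
      field_simp
      ring
    have h2 : (2 : ℝ) ≤ p * (q + u) + 1 := by nlinarith [hu.1]
    have h3 : (2 : ℝ) ≤ p * (q + v) + 1 := by nlinarith [hv.1]
    have h4 : (4 : ℝ) ≤ (p * (q + u) + 1) * (p * (q + v) + 1) := by nlinarith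
    rw [e, abs_div, abs_of_pos (by linarith : (0 : ℝ) < (p * (q + u) + 1) * (p * (q + v) + 1)),
      div_le_iff₀ (by linarith), pow_add]
    have h5 : (0 : ℝ) < (1 / 2) ^ n := by positivity
    nlinarith

lemma tendsto_two_mul_half_pow : Tendsto (fun n : ℕ => (2 : ℝ) * (1 / 2) ^ n) atTop (𝓝 0) := by
  simpa using (tendsto_pow_atTop_nhds_zero_of_lt_one (r := (1 / 2 : ℝ)) (by norm_num)
    (by norm_num)).const_mul 2

/-- The convergents `n` and `n + j` are images under the same `cfMap a n` of two points of the unit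
interval, so they form a Cauchy sequence. -/
lemma exists_isContFracExpansion {a : ℕ → ℕ} (ha : ∀ i, 0 < a i) :
    ∃ x ∈ Set.Icc (0 : ℝ) 1, IsContFracExpansion a x := by
  have h0 : (0 : ℝ) ∈ Set.Icc (0 : ℝ) 1 := by simp
  have hc : CauchySeq fun n => cfMap a n 0 := by
    refine cauchySeq_of_le_tendsto_0' _ (fun n m hnm => ?_) tendsto_two_mul_half_pow
    obtain ⟨j, rfl⟩ := Nat.exists_eq_add_of_le hnm
    rw [Real.dist_eq, cfMap_add]
    exact abs_cfMap_sub_le ha h0 (cfMap_mem (fun i => ha (i + n)) h0 j) n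
  obtain ⟨x, hx⟩ := cauchySeq_tendsto_of_complete hc
  exact ⟨x, isClosed_Icc.mem_of_tendsto hx (Eventually.of_forall fun n => cfMap_mem ha h0 n), ha,
    by simpa only [funext (convs'_contFrac a)] using hx⟩

lemma IsContFracExpansion.eq {a : ℕ → ℕ} {x y : ℝ} (hx : IsContFracExpansion a x)
    (hy : IsContFracExpansion a y) : x = y := tendsto_nhds_unique hx.2 hy.2

lemma IsContFracExpansion.mem_Icc {a : ℕ → ℕ} {x : ℝ} (hx : IsContFracExpansion a x) :
    x ∈ Set.Icc (0 : ℝ) 1 := by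
  obtain ⟨y, hy, hy'⟩ := exists_isContFracExpansion hx.1
  rwa [hx.eq hy']

lemma IsContFracExpansion.exists_tail {a : ℕ → ℕ} {x : ℝ} (hx : IsContFracExpansion a x) :
    ∃ y, IsContFracExpansion (fun i => a (i + 1)) y ∧ x = 1 / (a 0 + y) := by
  obtain ⟨y, hy, hy'⟩ := exists_isContFracExpansion (a := fun i => a (i + 1)) fun i => hx.1 (i + 1)
  refine ⟨y, hy', tendsto_nhds_unique ((tendsto_add_atTop_iff_nat 1).2 hx.2) ?_⟩
  have h0 : (1 : ℝ) ≤ a 0 := by exact_mod_cast hx.1 0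
  have := ((hy'.2.const_add (a 0 : ℝ)).inv₀ (by linarith [hy.1] : (a 0 : ℝ) + y ≠ 0))
  simpa only [convs'_contFrac, cfMap, one_div] using this

lemma IsContFracExpansion.mem_Ioo {a : ℕ → ℕ} {x : ℝ} (hx : IsContFracExpansion a x) :
    x ∈ Set.Ioo (0 : ℝ) 1 := by
  have pos : ∀ {a : ℕ → ℕ} {x : ℝ}, IsContFracExpansion a x → 0 < x := by
    intro a x hx
    obtain ⟨y, hy, rfl⟩ := hx.exists_tail
    have := hy.mem_Icc.1
    have h0 : (1 : ℝ) ≤ a 0 := by exact_mod_cast hx.1 0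
    positivity
  refine ⟨pos hx, ?_⟩
  obtain ⟨y, hy, rfl⟩ := hx.exists_tail
  have := pos hy
  have h0 : (1 : ℝ) ≤ a 0 := by exact_mod_cast hx.1 0
  rw [div_lt_one (by linarith)]
  linarith

/-- Euclidean descent: if `q x = p` with `q > 0`, then `0 < p < q`, and the tail `y` satisfies `p y
= q - a 0 * p`, which has the smaller denominator `p`. -/
lemma IsContFracExpansion.irrational {a : ℕ → ℕ} {x : ℝ} (hx : IsContFracExpansion a x) :
    Irrational x := by
  have key : ∀ (q p : ℕ) (a : ℕ → ℕ) (x : ℝ), IsContFracExpansion a x → (q : ℝ) * x ≠ p ∨ q = 0 := by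
    intro q
    induction q using Nat.strong_induction_on with
    | _ q ih =>
      intro p a x hx
      by_contra! h
      obtain ⟨h, hq⟩ := h
      have hq' : (0 : ℝ) < q := by exact_mod_cast Nat.pos_of_ne_zero hq
      have hI := hx.mem_Ioo
      have hp : (0 : ℝ) < p := by rw [← h]; exact mul_pos hq' hI.1
      have hpq : (p : ℝ) < q := by rw [← h]; nlinarith [hI.2]
      obtain ⟨y, hy, rfl⟩ := hx.exists_tail
      have h0 : (0 : ℝ) ≤ a 0 := Nat.cast_nonneg _
      have hyI := hy.mem_Ioo
      have e : (q : ℝ) = p * (a 0 + y) := by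
        rw [← h]
        have : (a 0 : ℝ) + y ≠ 0 := by linarith [hyI.1]
        field_simp
      have h1 : a 0 * p ≤ q := by
        have : (a 0 : ℝ) * p ≤ q := by rw [e]; nlinarith [hyI.1]
        exact_mod_cast this
      rcases ih p (by exact_mod_cast hpq) (q - a 0 * p) _ y hy with h2 | h2
      · apply h2
        rw [Nat.cast_sub h1]
        push_cast
        rw [e]
        ring
      · rw [h2] at hp
        simp at hp
  rintro ⟨r, rfl⟩
  have hpos := hx.mem_Ioo.1
  have hr : 0 ≤ r.num := by
    rw [Rat.num_nonneg]
    exact_mod_cast hpos.le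
  rcases key r.den r.num.toNat a r hx with h | h
  · apply h
    have h1 : ((r.num.toNat : ℤ) : ℝ) = (r.num : ℝ) := by rw [Int.toNat_of_nonneg hr]
    have h2 : (r.den : ℝ) * (r : ℝ) = r.num := by
      rw [mul_comm]
      exact_mod_cast Rat.mul_den_eq_num r
    rw [h2, ← h1, Int.cast_natCast]
  · exact r.den_ne_zero h

theorem exists_irr_of_pos {a : ℕ → ℕ} (ha : ∀ i, 0 < a i) :
    ∃ x : Irr, IsContFracExpansion a (x : ℝ) := by
  obtain ⟨x, -, hx⟩ := exists_isContFracExpansion ha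
  exact ⟨⟨x, hx.mem_Ioo.1, hx.mem_Ioo.2, hx.irrational⟩, hx⟩

/-- The first partial quotient is `⌊x⁻¹⌋₊` because the tail lies strictly between `0` and `1`; then
the tail is determined as well. -/
theorem IsContFracExpansion.unique {a b : ℕ → ℕ} {x : ℝ} (ha : IsContFracExpansion a x)
    (hb : IsContFracExpansion b x) : a = b := by
  have head : ∀ {a : ℕ → ℕ} {x : ℝ}, IsContFracExpansion a x → a 0 = ⌊x⁻¹⌋₊ ∧
      IsContFracExpansion (fun i => a (i + 1)) (x⁻¹ - ⌊x⁻¹⌋₊) := by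
    intro a x hx
    obtain ⟨y, hy, rfl⟩ := hx.exists_tail
    have hI := hy.mem_Ioo
    have e : ⌊(1 / ((a 0 : ℝ) + y))⁻¹⌋₊ = a 0 := by
      rw [one_div, inv_inv, Nat.floor_eq_iff (by linarith [hI.1, (Nat.cast_nonneg (a 0) : (0:ℝ) ≤ a 0)])]
      constructor <;> linarith [hI.1, hI.2]
    refine ⟨e.symm, ?_⟩
    rw [e, one_div, inv_inv, add_sub_cancel_left]
    exact hy
  funext n
  induction n generalizing a b x with
  | zero => rw [(head ha).1, (head hb).1]
  | succ n ih => exact ih (head ha).2 (head hb).2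

/-- With `f n` the iterates of the Gauss map, `x` is the value of `cfMap a n` at `f n`, while the
convergent is its value at `0`; the contraction estimate compares the two. -/
theorem exists_expansion_of_irr {x : ℝ} (hx : x ∈ Irr) : ∃ a, IsContFracExpansion a x := by
  let f : ℕ → ℝ := fun n => (fun t : ℝ => t⁻¹ - ⌊t⁻¹⌋₊)^[n] x
  have hf : ∀ n, f n ∈ Irr := by
    intro n
    induction n with
    | zero => exact hx
    | succ n ih =>
      have e : f (n + 1) = (f n)⁻¹ - ⌊(f n)⁻¹⌋₊ := Function.iterate_succ_apply' _ _ _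
      obtain ⟨h1, h2, h3⟩ := ih
      have h4 : Irrational (f (n + 1)) := by
        rw [e]
        exact h3.inv.sub_natCast _
      have h5 := Nat.floor_le (inv_pos.2 h1).le
      have h6 := Nat.lt_floor_add_one (f n)⁻¹
      exact ⟨lt_of_le_of_ne (by rw [e]; linarith) h4.ne_zero.symm, by rw [e]; linarith, h4⟩
  let a : ℕ → ℕ := fun n => ⌊(f n)⁻¹⌋₊
  have ha : ∀ n, 0 < a n := fun n => Nat.floor_pos.2 (one_le_inv_iff₀.2 ⟨(hf n).1, (hf n).2.1.le⟩)
  have hmap : ∀ n m, f m = cfMap (fun i => a (i + m)) n (f (n + m)) := by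
    intro n
    induction n with
    | zero => intro m; simp [cfMap]
    | succ n ih =>
      intro m
      have h1 := ih (m + 1)
      have e : f (m + 1) = (f m)⁻¹ - a m := Function.iterate_succ_apply' _ _ _
      have h2 : cfMap (fun i => a (i + 1 + m)) n (f (n + 1 + m)) = f (m + 1) := by
        rw [h1]
        simp only [show ∀ i, i + 1 + m = i + (m + 1) by intro i; omega]
      rw [cfMap, h2, e]
      simp
  refine ⟨a, ha, ?_⟩
  rw [funext (convs'_contFrac a)]
  rw [tendsto_iff_dist_tendsto_zero]
  refine squeeze_zero (fun _ => dist_nonneg) (fun n => ?_) tendsto_two_mul_half_pow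
  have h := hmap n 0
  simp only [add_zero] at h
  rw [Real.dist_eq, show x = f 0 from rfl, h]
  exact abs_cfMap_sub_le ha (by simp) ⟨(hf n).1.le, (hf n).2.1.le⟩ n

/-! ### Words as sequences of blocks -/

section Flat

variable {α β : Type*}

lemma exists_cut_add {p : ℕ → List α} (hp : ∀ n, p n ≠ []) (k : ℕ) :
    ∃ n i, i < (p n).length ∧ k = cut p n + i := by
  have hex : ∃ n, k < cut p n := ⟨k + 1, (strictMono_cut hp).id_le (k + 1)⟩
  have h1 := Nat.find_spec hex
  have h2 := fun j => Nat.find_min hex (m := j)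
  generalize Nat.find hex = n at h1 h2
  cases n with
  | zero => simp at h1
  | succ n =>
    have := not_lt.1 (h2 n (Nat.lt_succ_self n))
    rw [cut_succ] at h1
    exact ⟨n, k - cut p n, by omega, by omega⟩

variable [Inhabited α] [Inhabited β]

lemma flat_cut_add {p : ℕ → List α} (hp : ∀ n, p n ≠ []) (n i : ℕ) (hi : i < (p n).length) :
    flat p (cut p n + i) = (p n)[i] := by
  have h : seg (flat p) (cut p n) (cut p (n + 1)) = p n := by
    rw [seg_flat hp (Nat.le_succ n), seg_succ, List.flatten_singleton]
  have h' : i < (seg (flat p) (cut p n) (cut p (n + 1))).length := by rwa [h]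
  rw [← getElem_seg _ _ _ _ h']
  simp only [h]

lemma map_flat (f : α → β) {p : ℕ → List α} (hp : ∀ n, p n ≠ []) (n : ℕ) :
    f (flat p n) = flat (fun i => (p i).map f) n := by
  refine flat_rel (R := fun a b => f a = b) hp (fun n => ?_) n
  rw [List.forall₂_map_right_iff]
  exact List.forall₂_same.2 fun _ _ => rfl

/-- Moves the separator from the front of each block to its end, as codings begin with `#` whereas
in track words each block ends with `#`. -/
lemma flat_cons_eq (p : ℕ → List α) (a : α) :
    flat (fun i => a :: p i) = fun n => Nat.casesOn n a (flat fun i => p i ++ [a]) := by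
  have h1 : ∀ n, (fun i => a :: p i) n ≠ [] := by simp
  have h2 : ∀ n, (fun i => p i ++ [a]) n ≠ [] := by simp
  have key : ∀ N, a :: (seg (fun i => p i ++ [a]) 0 N).flatten =
      (seg (fun i => a :: p i) 0 N).flatten ++ [a] := by
    intro N
    induction N with
    | zero => simp [seg]
    | succ N ih =>
      rw [seg_succ_right _ (Nat.zero_le N), seg_succ_right _ (Nat.zero_le N), List.flatten_append,
        List.flatten_append, ← List.cons_append, ih]
      simp
  have get : ∀ {q : ℕ → List α}, (∀ n, q n ≠ []) → ∀ k N, (h : k < (seg q 0 N).flatten.length) →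
      flat q k = (seg q 0 N).flatten[k] := by
    intro q hq k N h
    have h' : k < (seg (flat q) 0 (cut q N)).length := by rwa [seg_flat_zero hq]
    have := getElem_seg (flat q) 0 (cut q N) k h'
    rw [Nat.zero_add] at this
    rw [← this]
    simp only [seg_flat_zero hq]
  funext n
  have hn : n < (seg (fun i => a :: p i) 0 (n + 1)).flatten.length :=
    (strictMono_cut h1).id_le (n + 1)
  rw [get h1 n (n + 1) hn]
  have e : (seg (fun i => a :: p i) 0 (n + 1)).flatten[n] =
      ((seg (fun i => a :: p i) 0 (n + 1)).flatten ++ [a])[n]'(by rw [List.length_append]; omega) :=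
    (List.getElem_append_left hn).symm
  rw [e]
  simp only [← key]
  cases n with
  | zero => rfl
  | succ k =>
    rw [List.getElem_cons_succ, ← get h2]

end Flat

/-- The word `B₀ # B₁ # B₂ # ⋯`. -/
def blockWord {m : ℕ} (B : ℕ → List (Fin m → Bool)) : ℕ → Letter m :=
  flat fun i => (B i).map some ++ [none]

/-- The binary words on the track `j`. -/
def blockTrack {m : ℕ} (B : ℕ → List (Fin m → Bool)) (j : Fin m) (i : ℕ) : List Bool :=
  (B i).map fun f => f j

lemma hashWord_eq_flat (b : ℕ → List Bool) :
    hashWord b = flat fun i => (none : HashSym) :: (b i).map some := by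
  funext n
  simp only [hashWord, flat, seg, List.flatMap_def, List.range_eq_range', Nat.sub_zero]
  rfl

lemma tracks_blockWord {m k : ℕ} (v : Fin k → Fin m) (B : ℕ → List (Fin m → Bool)) :
    tracks v (blockWord B) = convolution fun j => hashWord (blockTrack B (v j)) := by
  funext n j
  rw [convolution, hashWord_eq_flat, flat_cons_eq]
  cases n with
  | zero => rfl
  | succ n =>
    change (blockWord B n).map (fun f => f (v j)) = flat _ n
    rw [blockWord, map_flat (Option.map fun f : Fin m → Bool => f (v j)) (by simp)]
    congr 1
    funext i
    simp [blockTrack, Function.comp_def]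

/-- The separators sit at the same positions: if one block were shorter, the `#` that follows it
would meet a digit of the other word. -/
lemma hashWord_injective : Function.Injective hashWord := by
  intro b b' h
  rw [hashWord_eq_flat, hashWord_eq_flat] at h
  have key : ∀ (b b' : ℕ → List Bool) (_ : flat (fun i => (none : HashSym) :: (b i).map some) =
      flat fun i => (none : HashSym) :: (b' i).map some) (n : ℕ)
      (_ : cut (fun i => (none : HashSym) :: (b i).map some) n =
        cut (fun i => (none : HashSym) :: (b' i).map some) n),
      (b' n).length ≤ (b n).length := by
    intro b b' h n hc
    by_contra! hlt
    have hp : ∀ i, (fun i => (none : HashSym) :: (b i).map some) i ≠ [] := by simp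
    have hp' : ∀ i, (fun i => (none : HashSym) :: (b' i).map some) i ≠ [] := by simp
    have h1 := flat_cut_add hp (n + 1) 0 (by simp)
    have h2 := flat_cut_add hp' n ((b n).length + 1) (by simpa using hlt)
    rw [cut_succ, hc, h] at h1
    simp only [List.length_cons, List.length_map, Nat.add_zero] at h1
    rw [h1] at h2
    simp at h2
  have hcut : ∀ n, cut (fun i => (none : HashSym) :: (b i).map some) n =
      cut (fun i => (none : HashSym) :: (b' i).map some) n := by
    intro n
    induction n with
    | zero => simp
    | succ n ih =>
      rw [cut_succ, cut_succ, ih]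
      simpa using le_antisymm (key b' b h.symm n ih.symm) (key b b' h n ih)
  funext n
  have e1 := seg_flat (p := fun i => (none : HashSym) :: (b i).map some) (by simp) (Nat.le_succ n)
  have e2 := seg_flat (p := fun i => (none : HashSym) :: (b' i).map some) (by simp) (Nat.le_succ n)
  rw [hcut, hcut, h, e2, seg_succ, seg_succ] at e1
  simpa using (List.map_injective_iff.2 (Option.some_injective _) (by simpa using e1) :
    b' n = b n).symm

lemma hashWord_mem_hashR {b : ℕ → List Bool} : hashWord b ∈ hashR ↔ ∀ i, true ∈ b i := by
  constructor
  · rintro ⟨b', hb', h⟩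
    rwa [hashWord_injective h]
  · exact fun h => ⟨b, h, rfl⟩

lemma binaryValue_pos {b : List Bool} : 0 < binaryValue b ↔ true ∈ b := by
  induction b with
  | nil => simp [binaryValue]
  | cons c b ih =>
    have e : binaryValue (c :: b) = c.toNat + 2 * binaryValue b := by
      simp [binaryValue, Nat.ofDigits_cons]
    rw [e, List.mem_cons, ← ih]
    cases c <;> simp

lemma binaryValue_append_replicate (b : List Bool) (n : ℕ) :
    binaryValue (b ++ List.replicate n false) = binaryValue b := by
  have : Nat.ofDigits 2 (List.replicate n 0) = 0 := by
    induction n with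
    | zero => rfl
    | succ n ih => simp [List.replicate_succ, Nat.ofDigits_cons, ih]
  simp [binaryValue, Nat.ofDigits_append, this]

/-- Equal lengths exclude differences by leading zeros. -/
lemma binaryValue_injective {b b' : List Bool} (hl : b.length = b'.length)
    (h : binaryValue b = binaryValue b') : b = b' := by
  induction b generalizing b' with
  | nil => exact (List.length_eq_zero_iff.1 hl.symm).symm
  | cons c b ih =>
    cases b' with
    | nil => simp at hl
    | cons c' b' =>
      have e : ∀ (c : Bool) (b : List Bool), binaryValue (c :: b) = c.toNat + 2 * binaryValue b := by
        simp [binaryValue, Nat.ofDigits_cons]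
      rw [e, e] at h
      have h1 := Bool.toNat_lt c
      have h2 := Bool.toNat_lt c'
      rw [ih (by simpa using hl) (by omega)]
      cases c <;> cases c' <;> simp at h <;> first | rfl | omega

lemma exists_binaryValue (n : ℕ) : ∃ b, binaryValue b = n := by
  refine ⟨(Nat.digits 2 n).map fun d => d == 1, ?_⟩
  rw [binaryValue, List.map_map]
  conv_rhs => rw [← Nat.ofDigits_digits 2 n]
  congr 1
  conv_rhs => rw [← List.map_id (Nat.digits 2 n)]
  refine List.map_congr_left fun d hd => ?_
  have := Nat.digits_lt_base Nat.one_lt_two hd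
  interval_cases d <;> rfl

/-! ### Padding -/

/-- The letter `g` without the last track. -/
def dropLast {m : ℕ} (g : Fin (m + 1) → Bool) : Fin m → Bool := fun j => g j.castSucc

@[simp] lemma dropLast_extend {m : ℕ} (f : Fin m → Bool) (b : Bool) :
    dropLast (extend f b) = f := by
  funext j
  exact Fin.snoc_castSucc (α := fun _ => Bool) b f j

@[simp] lemma extend_dropLast {m : ℕ} (g : Fin (m + 1) → Bool) :
    extend (dropLast g) (g (Fin.last m)) = g := Fin.snoc_init_self (α := fun _ => Bool) g

@[simp] lemma extend_last {m : ℕ} (f : Fin m → Bool) (b : Bool) :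
    extend f b (Fin.last m) = b := Fin.snoc_last (α := fun _ => Bool) b f

/-- Only the final `#` can produce additional letters, so the old tracks are lengthened exactly at
the most significant end. -/
lemma mem_wordSub_padSub {m : ℕ} {b : List (Fin m → Bool)} {v : List (Letter (m + 1))} :
    v ∈ wordSub (padSub m) (b.map some ++ [none]) ↔ ∃ b' : List (Fin (m + 1) → Bool),
      (∃ n, b'.map dropLast = b ++ List.replicate n fun _ => false) ∧ v = b'.map some ++ [none] := by
  induction b generalizing v with
  | nil =>
    rw [List.map_nil, List.nil_append, mem_wordSub_singleton]
    constructor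
    · rintro ⟨z, rfl⟩
      refine ⟨z.map (extend fun _ => false), ⟨z.length, ?_⟩, ?_⟩
      · simp [Function.comp_def, List.map_const']
      · simp [Function.comp_def]
    · rintro ⟨b', ⟨n, hn⟩, rfl⟩
      refine ⟨b'.map fun g => g (Fin.last m), ?_⟩
      rw [List.map_map]
      congr 1
      refine List.map_congr_left fun g hg => ?_
      have : dropLast g ∈ b'.map dropLast := List.mem_map_of_mem hg
      rw [hn, List.nil_append] at this
      rw [Function.comp_apply, ← List.eq_of_mem_replicate this, extend_dropLast]
  | cons f b ih =>
    rw [List.map_cons, List.cons_append, ← List.singleton_append, mem_wordSub_append]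
    simp only [mem_wordSub_singleton, ih]
    constructor
    · rintro ⟨_, ⟨c, rfl⟩, _, ⟨b', ⟨n, hn⟩, rfl⟩, rfl⟩
      exact ⟨extend f c :: b', ⟨n, by simp [hn]⟩, by simp⟩
    · rintro ⟨b', ⟨n, hn⟩, rfl⟩
      cases b' with
      | nil => simp at hn
      | cons g b' =>
        simp only [List.map_cons, List.cons_append, List.cons.injEq] at hn
        exact ⟨_, ⟨g (Fin.last m), rfl⟩, _, ⟨b', ⟨n, hn.2⟩, rfl⟩, by simp [← hn.1]⟩

theorem isImage_padSub_iff {m : ℕ} {B : ℕ → List (Fin m → Bool)} {y : ℕ → Letter (m + 1)} :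
    IsImage (padSub m) (blockWord B) y ↔ ∃ B' : ℕ → List (Fin (m + 1) → Bool),
      (∀ i, ∃ n, (B' i).map dropLast = B i ++ List.replicate n fun _ => false) ∧
        y = blockWord B' := by
  rw [blockWord, isImage_flat_iff nil_notMem_padSub (by simp)]
  simp only [mem_wordSub_padSub]
  constructor
  · rintro ⟨v, hv, rfl⟩
    choose B' h1 h2 using hv
    exact ⟨B', h1, congrArg flat (funext h2)⟩
  · rintro ⟨B', h, rfl⟩
    exact ⟨_, fun i => ⟨B' i, h i, rfl⟩, rfl⟩

/-! ### Codings of tuples -/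

/-- The blocks code the continued fractions of the numbers `v j` on the tracks. -/
def Codes {m : ℕ} (B : ℕ → List (Fin m → Bool)) (v : Fin m → Irr) : Prop :=
  ∀ j, IsContFracExpansion (fun i => binaryValue (blockTrack B j i)) (v j : ℝ)

lemma blockTrack_castSucc {m : ℕ} {B : ℕ → List (Fin m → Bool)}
    {B' : ℕ → List (Fin (m + 1) → Bool)} {i n : ℕ}
    (h : (B' i).map dropLast = B i ++ List.replicate n fun _ => false) (j : Fin m) :
    blockTrack B' j.castSucc i = blockTrack B j i ++ List.replicate n false := by
  have := congrArg (List.map fun f : Fin m → Bool => f j) h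
  simpa [blockTrack, dropLast, Function.comp_def] using this

lemma Codes.snoc {m : ℕ} {B : ℕ → List (Fin m → Bool)} {v : Fin m → Irr} (h : Codes B v)
    {B' : ℕ → List (Fin (m + 1) → Bool)}
    (hB : ∀ i, ∃ n, (B' i).map dropLast = B i ++ List.replicate n fun _ => false) {a : Irr}
    (ha : IsContFracExpansion (fun i => binaryValue (blockTrack B' (Fin.last m) i)) (a : ℝ)) :
    Codes B' (Fin.snoc (α := fun _ => Irr) v a) := by
  intro j
  refine Fin.lastCases ?_ (fun j => ?_) j
  · rwa [Fin.snoc_last (α := fun _ => Irr)]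
  · rw [Fin.snoc_castSucc (α := fun _ => Irr)]
    convert h j using 2 with i
    obtain ⟨n, hn⟩ := hB i
    rw [blockTrack_castSucc hn, binaryValue_append_replicate]

/-- The shorter of the two words is filled up with zeros. -/
lemma exists_pad {m : ℕ} (b : List (Fin m → Bool)) (d : List Bool) :
    ∃ b' : List (Fin (m + 1) → Bool), (∃ n, b'.map dropLast = b ++ List.replicate n fun _ => false) ∧
      ∃ n, b'.map (fun g => g (Fin.last m)) = d ++ List.replicate n false := by
  induction b generalizing d with
  | nil =>
    refine ⟨d.map (extend fun _ => false), ⟨d.length, ?_⟩, 0, ?_⟩ <;>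
      simp [Function.comp_def, List.map_const']
  | cons f b ih =>
    cases d with
    | nil =>
      obtain ⟨b', ⟨n, hn⟩, k, hk⟩ := ih []
      exact ⟨extend f false :: b', ⟨n, by simp [hn]⟩, k + 1, by simp [hk, List.replicate_succ]⟩
    | cons c d =>
      obtain ⟨b', ⟨n, hn⟩, k, hk⟩ := ih d
      exact ⟨extend f c :: b', ⟨n, by simp [hn]⟩, k, by simp [hk]⟩

lemma Codes.exists_snoc {m : ℕ} {B : ℕ → List (Fin m → Bool)} {v : Fin m → Irr} (h : Codes B v)
    (a : Irr) : ∃ B' : ℕ → List (Fin (m + 1) → Bool),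
      (∀ i, ∃ n, (B' i).map dropLast = B i ++ List.replicate n fun _ => false) ∧
        Codes B' (Fin.snoc (α := fun _ => Irr) v a) := by
  obtain ⟨c, hc⟩ := exists_expansion_of_irr a.2
  choose d hd using fun i => exists_binaryValue (c i)
  choose B' h1 k hk using fun i => exists_pad (B i) (d i)
  refine ⟨B', h1, h.snoc h1 ?_⟩
  convert hc using 2 with i
  rw [blockTrack, hk, binaryValue_append_replicate, hd]

lemma Codes.true_mem {m : ℕ} {B : ℕ → List (Fin m → Bool)} {v : Fin m → Irr} (h : Codes B v)
    (j : Fin m) (i : ℕ) : true ∈ blockTrack B j i := binaryValue_pos.1 ((h j).1 i)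

/-- Tracks of one coding have the same block lengths, so equal partial quotients have equal digits;
this makes equality recognizable. -/
lemma Codes.blockTrack_eq_iff {m : ℕ} {B : ℕ → List (Fin m → Bool)} {v : Fin m → Irr}
    (h : Codes B v) (j k : Fin m) : blockTrack B j = blockTrack B k ↔ v j = v k := by
  constructor
  · intro e
    have := h j
    rw [e] at this
    exact Subtype.ext (this.eq (h k))
  · intro e
    have := h j
    rw [e] at this
    funext i
    exact binaryValue_injective (by simp [blockTrack]) (congrFun (this.unique (h k)) i)

/-! ### Automata for equality and for valid codings -/

/-- The transitions of the automaton for the equality of two tracks. -/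
def eqTrans : List (Fin 1 × (Fin 2 → HashSym) × Fin 1) :=
  [(0, ![none, none], 0), (0, ![some false, some false], 0), (0, ![some true, some true], 0)]

/-- The automaton for the equality of two tracks. -/
def eqAut : BuchiAutomaton (Fin 2 → HashSym) where
  numStates := 1
  trans := eqTrans
  init := [0]
  accept := [0]

lemma mem_language_eqAut {z : ℕ → Fin 2 → HashSym} :
    z ∈ eqAut.language ↔ ∀ n, z n 0 = z n 1 := by
  have ht : ∀ (p : Fin 1) (a b : HashSym) (q : Fin 1), (p, ![a, b], q) ∈ eqTrans ↔ a = b := by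
    decide
  have hz : ∀ n, z n = ![z n 0, z n 1] := fun n => by
    funext j
    fin_cases j <;> rfl
  constructor
  · rintro ⟨s, -, hs, -⟩ n
    have := hs n
    rw [hz] at this
    exact (ht _ _ _ _).1 this
  · intro h
    refine ⟨fun _ => (0 : Fin 1), List.mem_singleton.2 rfl, fun n => ?_, ?_⟩
    · rw [hz]
      exact (ht _ _ _ _).2 (h n)
    · exact Set.infinite_univ.mono fun n _ => List.mem_singleton.2 rfl

/-- The transitions of the automaton for the words all of whose blocks contain the letter `1`. -/
def valTrans : List (Fin 3 × (Fin 1 → HashSym) × Fin 3) :=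
  [(2, ![none], 0), (0, ![some false], 1), (0, ![some true], 2), (1, ![some false], 1),
    (1, ![some true], 2), (2, ![some false], 2), (2, ![some true], 2)]

/-- The automaton for the words all of whose blocks contain the letter `1`. -/
def valAut : BuchiAutomaton (Fin 1 → HashSym) where
  numStates := 3
  trans := valTrans
  init := [2]
  accept := [0]

/-- The transition function of `valAut`. -/
def valStep (q : Fin 3) : HashSym → Fin 3
  | none => 0
  | some true => 2
  | some false => if q = 2 then 2 else 1

lemma foldl_valStep (l : List Bool) (q : Fin 3) :
    (l.map some).foldl valStep q = 2 ↔ q = 2 ∨ true ∈ l := by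
  induction l generalizing q with
  | nil => simp
  | cons b l ih =>
    rw [List.map_cons, List.foldl_cons, ih]
    cases b
    · have : valStep q (some false) = 2 ↔ q = 2 := by
        revert q
        decide
      simp [this]
    · simp [valStep]

/-- State `0` means that `#` was just read, `1` that only zeros followed it, `2` that a `1` was read
since. The letter `#` is allowed only in state `2`, which is also initial because of the `#` in
front. Acceptance is automatic, as `0` is visited after each `#`. -/
lemma mem_language_valAut {b : ℕ → List Bool} :
    (convolution fun _ : Fin 1 => hashWord b) ∈ valAut.language ↔ ∀ i, true ∈ b i := by
  let p : ℕ → List HashSym := fun i => none :: (b i).map some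
  have hp : ∀ i, p i ≠ [] := by simp [p]
  have ht : ∀ (q : Fin 3) (a : HashSym) (q' : Fin 3), (q, ![a], q') ∈ valTrans ↔
      q' = valStep q a ∧ (a = none → q = 2) := by
    decide
  have hz : ∀ n, convolution (fun _ : Fin 1 => hashWord b) n = ![flat p n] := fun n => by
    funext j
    rw [convolution, hashWord_eq_flat]
    fin_cases j
    rfl
  have hcut : ∀ i, flat p (cut p i) = none := fun i => flat_cut_add hp i 0 (by simp [p])
  have key : ∀ s : ℕ → Fin 3, (∀ n, s (n + 1) = valStep (s n) (flat p n)) → ∀ i,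
      s (cut p (i + 1)) = 2 ↔ true ∈ b i := by
    intro s hs i
    -- After `#` the state is `0` whatever came before, so each block is read afresh.
    have h0 : s (cut p i + 1) = 0 := by rw [hs, hcut]; rfl
    have h1 : ∀ t ≤ (b i).length, s (cut p i + 1 + t) = (((b i).take t).map some).foldl valStep 0 := by
      intro t ht
      induction t with
      | zero => simpa using h0
      | succ t ih =>
        have e : flat p (cut p i + 1 + t) = some (b i)[t] := by
          rw [add_assoc, add_comm 1 t, flat_cut_add hp i (t + 1) (by simp [p]; omega)]
          simp [p]
        rw [← add_assoc, hs, e, ih (by omega), List.take_succ_eq_append_getElem (by omega),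
          List.map_append, List.foldl_append]
        rfl
    have h2 : cut p (i + 1) = cut p i + 1 + (b i).length := by
      rw [cut_succ]
      simp only [p, List.length_cons, List.length_map]
      omega
    rw [h2, h1 _ le_rfl, List.take_length, foldl_valStep]
    simp
  constructor
  · rintro ⟨s, -, hs, -⟩ i
    have hs' : ∀ n, s (n + 1) = valStep (s n) (flat p n) ∧ (flat p n = none → s n = (2 : Fin 3)) :=
      fun n => by
        have := hs n
        rw [hz] at this
        exact (ht _ _ _).1 this
    exact (key s (fun n => (hs' n).1) i).1 ((hs' _).2 (hcut _))
  · intro h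
    let s : ℕ → Fin 3 := fun n => Nat.rec 2 (fun n q => valStep q (flat p n)) n
    have hs : ∀ n, s (n + 1) = valStep (s n) (flat p n) := fun n => rfl
    have hs2 : ∀ i, s (cut p i) = 2 := by
      intro i
      cases i with
      | zero => rw [cut_zero]; rfl
      | succ i => exact (key s hs i).2 (h i)
    refine ⟨s, List.mem_singleton.2 rfl, fun n => ?_, ?_⟩
    · rw [hz]
      refine (ht _ _ _).2 ⟨hs n, fun h0 => ?_⟩
      obtain ⟨i, j, hj, rfl⟩ := exists_cut_add hp n
      rw [flat_cut_add hp i j hj] at h0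
      cases j with
      | zero => exact hs2 i
      | succ j => simp [p] at h0
    · refine Set.infinite_of_forall_exists_gt fun n => ⟨cut p n + 1, ?_, ?_⟩
      · refine List.mem_singleton.2 ?_
        rw [hs, hcut]
        rfl
      · exact Nat.lt_succ_of_le ((strictMono_cut hp).id_le n)

/-! ### Evaluation of formulas -/

/-- The recognizers with `0, …, B - 1` tracks for the formula whose Gödel number is the length of
the list of the recognizers for smaller numbers. -/
def evalStep (auts : List (ℕ × AutomatonData)) (B : ℕ) (prev : List (List Recognizer)) :
    List Recognizer :=
  (List.range B).map fun m =>
    if prev.length.unpair.1 = 1 then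
      atomRec eqAut.data [prev.length.unpair.2.unpair.1, prev.length.unpair.2.unpair.2] m
    else if prev.length.unpair.1 = 2 then
      atomRec (auts.getD prev.length.unpair.2.unpair.1 (0, 0, [], [], [])).2
        ((Encodable.decode prev.length.unpair.2.unpair.2 : Option (List ℕ)).getD []) m
    else if prev.length.unpair.1 = 3 then
      impRec m ((prev.getD prev.length.unpair.2.unpair.1 []).getD m (0, [], [], []))
        ((prev.getD prev.length.unpair.2.unpair.2 []).getD m (0, [], [], []))
    else if prev.length.unpair.1 = 4 then
      allRec m (impRec (m + 1) (atomRec valAut.data [m] (m + 1))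
        ((prev.getD prev.length.unpair.2 []).getD (m + 1) (0, [], [], [])))
    else falseRec m

/-- The recognizers for the formulas with Gödel numbers less than `n`. -/
def evalTable (auts : List (ℕ × AutomatonData)) (B : ℕ) : ℕ → List (List Recognizer)
  | 0 => []
  | n + 1 => evalTable auts B n ++ [evalStep auts B (evalTable auts B n)]

/-- The recognizer with `m` tracks for the formula with Gödel number `c`. -/
def evalRec (auts : List (ℕ × AutomatonData)) (B c m : ℕ) : Recognizer :=
  (evalStep auts B (evalTable auts B c)).getD m (0, [], [], [])

section Eval

variable {auts : List (ℕ × AutomatonData)} {B m : ℕ}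

@[simp] lemma length_evalTable (c : ℕ) : (evalTable auts B c).length = c := by
  induction c with
  | zero => rfl
  | succ c ih => simp [evalTable, ih]

lemma getD_evalTable {i c : ℕ} (h : i < c) :
    ((evalTable auts B c).getD i []).getD m (0, [], [], []) = evalRec auts B i m := by
  rw [evalRec]
  congr 1
  induction c with
  | zero => omega
  | succ c ih =>
    rw [evalTable]
    rcases Nat.lt_succ_iff_lt_or_eq.1 h with h' | rfl
    · rw [List.getD_append _ _ _ _ (by simpa using h'), ih h']
    · rw [List.getD_append_right _ _ _ _ (by simp)]
      simp

/-- Turns the table, which is a course-of-values recursion on Gödel numbers, into a structural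
recursion: components of `Nat.pair k d` with `k > 0` have smaller numbers. -/
lemma evalRec_pair (hm : m < B) (k d : ℕ) : evalRec auts B (Nat.pair k d) m =
    if k = 1 then atomRec eqAut.data [d.unpair.1, d.unpair.2] m
    else if k = 2 then atomRec (auts.getD d.unpair.1 (0, 0, [], [], [])).2
        ((Encodable.decode d.unpair.2 : Option (List ℕ)).getD []) m
    else if k = 3 then impRec m (evalRec auts B d.unpair.1 m) (evalRec auts B d.unpair.2 m)
    else if k = 4 then
      allRec m (impRec (m + 1) (atomRec valAut.data [m] (m + 1)) (evalRec auts B d (m + 1)))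
    else falseRec m := by
  have hd : ∀ k d, 0 < k → d < Nat.pair k d := fun k d hk => by
    have := Nat.add_le_pair k d
    omega
  rw [evalRec, evalStep, List.getD_eq_getElem _ _ (by simpa using hm)]
  simp only [List.getElem_map, List.getElem_range, length_evalTable, Nat.unpair_pair]
  split_ifs with h1 h2 h3 h4
  · rfl
  · rfl
  · have := hd k d (by omega)
    rw [getD_evalTable ((Nat.unpair_left_le d).trans_lt this),
      getD_evalTable ((Nat.unpair_right_le d).trans_lt this)]
  · rw [getD_evalTable (hd k d (by omega))]
  · rfl

end Eval

/-- The decision procedure. -/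
def decideTheory (auts : List (ℕ × AutomatonData)) (g : ℕ) : Bool :=
  acceptsHashes (evalRec auts (g + 1) g 0)

/-! ### Correctness of the evaluation on codings -/

section Semantics

open FirstOrder Language

lemma exists_var {n m : ℕ} {ar : Fin n → ℕ} (t : (relLang ar).Term (Empty ⊕ Fin m)) :
    ∃ j : Fin m, t = Term.var (Sum.inr j) := by
  cases t with
  | var x =>
    cases x with
    | inl e => exact e.elim
    | inr j => exact ⟨j, rfl⟩
  | func f _ => exact Empty.elim f

lemma convolution_injective {k : ℕ} :
    Function.Injective (convolution : (Fin k → ℕ → HashSym) → ℕ → Fin k → HashSym) :=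
  fun _ _ h => funext fun j => funext fun i => congrFun (congrFun h i) j

/-- Tracks of one word are automatically aligned and, by `Codes`, lie in `hashR`; since `hashWord`
is injective, the coded tuple is the only one that can witness membership. -/
lemma tracks_mem_iff {k m : ℕ} {X : Set (Fin k → Irr)} {A : BuchiAutomaton (Fin k → HashSym)}
    (hA : RecognizableBy X A) (w : Fin k → Fin m) {B : ℕ → List (Fin m → Bool)} {v : Fin m → Irr}
    (h : Codes B v) : tracks w (blockWord B) ∈ A.language ↔ (fun j => v (w j)) ∈ X := by
  rw [show A.language = _ from hA, tracks_blockWord, convolution_injective.mem_set_image]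
  constructor
  · rintro ⟨-, -, x, hx, hc⟩
    convert hx with j
    obtain ⟨b, hb, hb'⟩ := hc j
    rw [← hashWord_injective hb] at hb'
    exact Subtype.ext ((h (w j)).eq hb')
  · intro hx
    refine ⟨fun j => hashWord_mem_hashR.2 (h.true_mem (w j)), fun i j n => ?_, _, hx,
      fun j => ⟨_, rfl, h (w j)⟩⟩
    have e := congrFun (tracks_blockWord w B) n
    change hashWord (blockTrack B (w i)) n = none ↔ hashWord (blockTrack B (w j)) n = none
    rw [show hashWord (blockTrack B (w i)) n = tracks w (blockWord B) n i from (congrFun e i).symm,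
      show hashWord (blockTrack B (w j)) n = tracks w (blockWord B) n j from (congrFun e j).symm]
    cases n <;> simp [tracks]

/-- The language is specified on codings only, where its members are determined by the coded tuple;
other words are irrelevant. A quantifier adds a track but lowers the Gödel number, so the bound on
`m + godelNumber φ` passes to subformulas and keeps the track count below `Bd`. -/
theorem recognizes_evalRec {n : ℕ} {ar : Fin n → ℕ} {X : ∀ i, Set (Fin (ar i) → Irr)}
    {A : ∀ i, BuchiAutomaton (Fin (ar i) → HashSym)} (hA : ∀ i, RecognizableBy (X i) (A i)) {m : ℕ}
    (φ : (relLang ar).BoundedFormula Empty m) {Bd : ℕ} (hBd : m + godelNumber φ < Bd) :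
    ∃ L, (evalRec (List.ofFn fun i => (ar i, (A i).data)) Bd (godelNumber φ) m).Recognizes L ∧
      ∀ (B : ℕ → List (Fin m → Bool)) (v : Fin m → Irr), Codes B v →
        (blockWord B ∈ L ↔ φ.Realize (M := IrrStructure X) default v) := by
  induction φ with
  | falsum =>
    refine ⟨∅, ?_, fun B v _ => ?_⟩
    · rw [godelNumber, evalRec_pair (by omega)]
      exact recognizes_falseRec _
    · simp [BoundedFormula.Realize]
  | @equal m s t =>
    obtain ⟨j, rfl⟩ := exists_var s
    obtain ⟨k, rfl⟩ := exists_var t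
    refine ⟨{x | tracks ![j, k] x ∈ eqAut.language}, ?_, fun B v h => ?_⟩
    · rw [godelNumber, evalRec_pair (by omega), if_pos rfl, Nat.unpair_pair]
      exact recognizes_atomRec eqAut ![j, k]
    · rw [Set.mem_ofPred_eq, mem_language_eqAut, tracks_blockWord]
      refine Iff.trans ?_ (h.blockTrack_eq_iff j k)
      rw [← hashWord_injective.eq_iff, funext_iff]
      rfl
  | @rel m k r ts =>
    obtain ⟨i, rfl⟩ := r
    choose w hw using fun j => exists_var (ts j)
    obtain rfl : ts = fun j => Term.var (Sum.inr (w j)) := funext hw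
    refine ⟨{x | tracks w x ∈ (A i).language}, ?_, fun B v h => ?_⟩
    · rw [godelNumber, evalRec_pair (by omega), if_neg (by omega), if_pos rfl, Nat.unpair_pair]
      simp only [Encodable.encodek, Option.getD_some]
      rw [List.getD_eq_getElem _ _ (by simp)]
      simp only [List.getElem_ofFn]
      exact recognizes_atomRec (A i) w
    · rw [Set.mem_ofPred_eq, tracks_mem_iff (hA i) w h]
      rfl
  | @imp m φ ψ ih₁ ih₂ =>
    have hle := Nat.add_le_pair 3 (Nat.pair (godelNumber φ) (godelNumber ψ))
    have hle' := Nat.add_le_pair (godelNumber φ) (godelNumber ψ)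
    rw [godelNumber] at hBd
    obtain ⟨L₁, h₁, h₁'⟩ := ih₁ (by omega)
    obtain ⟨L₂, h₂, h₂'⟩ := ih₂ (by omega)
    refine ⟨{x | x ∈ L₁ → x ∈ L₂}, ?_, fun B v h => ?_⟩
    · rw [godelNumber, evalRec_pair (by omega), if_neg (by omega), if_neg (by omega), if_pos rfl,
        Nat.unpair_pair]
      exact recognizes_impRec h₁ h₂
    · rw [Set.mem_ofPred_eq, h₁' B v h, h₂' B v h]
      rfl
  | @all m φ ih =>
    have hle := Nat.add_le_pair 4 (godelNumber φ)
    rw [godelNumber] at hBd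
    obtain ⟨L, h, h'⟩ := ih (by omega)
    refine ⟨{x | ∀ y, IsImage (padSub m) x y →
      tracks ![Fin.last m] y ∈ valAut.language → y ∈ L}, ?_, fun B v hv => ?_⟩
    · rw [godelNumber, evalRec_pair (by omega), if_neg (by omega), if_neg (by omega),
        if_neg (by omega), if_pos rfl]
      exact recognizes_allRec (recognizes_impRec (recognizes_atomRec valAut ![Fin.last m]) h)
    · have hval : ∀ B' : ℕ → List (Fin (m + 1) → Bool),
          tracks ![Fin.last m] (blockWord B') ∈ valAut.language ↔
            ∀ i, true ∈ blockTrack B' (Fin.last m) i := by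
        intro B'
        rw [← mem_language_valAut, tracks_blockWord]
        simp
      simp only [Set.mem_ofPred_eq, isImage_padSub_iff]
      constructor
      -- A given number is added on a padded coding of the old tuple.
      · intro hx a
        obtain ⟨B', h1, h2⟩ := hv.exists_snoc a
        exact (h' B' _ h2).1 (hx _ ⟨B', h1, rfl⟩ ((hval B').2 (h2.true_mem _)))
      -- Conversely, a valid new track codes some number, and padding has not changed the old ones.
      · rintro hx _ ⟨B', h1, rfl⟩ hB'
        obtain ⟨a, ha⟩ := exists_irr_of_pos fun i => binaryValue_pos.2 ((hval B').1 hB' i)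
        exact (h' B' _ (hv.snoc h1 ha)).2 (hx a)

theorem decideTheory_iff {n : ℕ} {ar : Fin n → ℕ} {X : ∀ i, Set (Fin (ar i) → Irr)}
    {A : ∀ i, BuchiAutomaton (Fin (ar i) → HashSym)} (hA : ∀ i, RecognizableBy (X i) (A i))
    (φ : (relLang ar).Sentence) :
    decideTheory (List.ofFn fun i => (ar i, (A i).data)) (godelNumber φ) = true ↔
      Sentence.Realize (IrrStructure X) φ := by
  obtain ⟨L, hL, hL'⟩ := recognizes_evalRec hA φ (Bd := godelNumber φ + 1) (by omega)
  rw [decideTheory, acceptsHashes_iff hL]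
  -- The empty tuple is coded by any blocks; empty ones give `#^ω`.
  have hw : (fun _ => none : ℕ → Letter 0) = blockWord fun _ => [] := by
    refine eq_flat strictMono_id rfl fun n => ?_
    rw [id, id, seg_succ]
    rfl
  rw [hw, hL' _ default fun j => j.elim0]
  rfl

end Semantics

/-! ### Primitive recursiveness -/

section Primrec

variable {α β γ δ σ : Type*} [Primcodable α] [Primcodable β] [Primcodable γ] [Primcodable δ]
  [Primcodable σ]

/-- Primitive recursive functions of three arguments. -/
def Primrec₃ (f : α → β → γ → σ) : Prop := Primrec fun q : α × β × γ => f q.1 q.2.1 q.2.2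

lemma Primrec₃.comp {f : α → β → γ → σ} (hf : Primrec₃ f) {a : δ → α} {b : δ → β} {c : δ → γ}
    (ha : Primrec a) (hb : Primrec b) (hc : Primrec c) : Primrec fun d => f (a d) (b d) (c d) :=
  Primrec.comp (f := fun q : α × β × γ => f q.1 q.2.1 q.2.2) hf (ha.pair (hb.pair hc))

lemma Primrec.list_any {f : α → List β} {p : α → β → Bool} (hf : Primrec f) (hp : Primrec₂ p) :
    Primrec fun a => (f a).any (p a) := by
  refine (Primrec.list_foldr (h := fun a x => p a x.1 || x.2) hf (Primrec.const false)
    (Primrec.or.comp (hp.comp Primrec.fst (Primrec.fst.comp Primrec.snd))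
      (Primrec.snd.comp Primrec.snd))).of_eq fun a => ?_
  induction f a with
  | nil => rfl
  | cons b l ih => rw [List.foldr_cons, List.any_cons, ih]

lemma Primrec.list_all {f : α → List β} {p : α → β → Bool} (hf : Primrec f) (hp : Primrec₂ p) :
    Primrec fun a => (f a).all (p a) := by
  refine (Primrec.not.comp (Primrec.list_any (p := fun a b => !p a b) hf
    (Primrec.not.comp hp))).of_eq fun a => ?_
  simp [List.all_eq_not_any_not]

lemma Primrec.nat_pow : Primrec₂ ((· ^ ·) : ℕ → ℕ → ℕ) := Primrec₂.unpaired'.1 Nat.Primrec.pow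

lemma Primrec.nat_testBit : Primrec₂ Nat.testBit := by
  refine ((Primrec.beq (α := ℕ)).comp (Primrec.nat_mod.comp (Primrec.nat_div.comp Primrec.fst
    (Primrec.nat_pow.comp (Primrec.const 2) Primrec.snd)) (Primrec.const 2))
    (Primrec.const 1)).to₂.of_eq fun n i => ?_
  rw [Nat.testBit_eq_decide_div_mod_eq]
  rfl

lemma Primrec.bool_toNat : Primrec Bool.toNat := Primrec.dom_bool _

lemma Primrec.bitSet {n : α → ℕ} {p : α → ℕ → Bool} (hn : Primrec n) (hp : Primrec₂ p) :
    Primrec fun a => bitSet (n a) (p a) :=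
  Primrec.list_foldr (h := fun a x => 2 ^ x.1 * (p a x.1).toNat + x.2) (Primrec.list_range.comp hn)
    (Primrec.const 0) (Primrec.nat_add.comp (Primrec.nat_mul.comp
      (Primrec.nat_pow.comp (Primrec.const 2) (Primrec.fst.comp Primrec.snd))
      (Primrec.bool_toNat.comp (hp.comp Primrec.fst (Primrec.fst.comp Primrec.snd))))
      (Primrec.snd.comp Primrec.snd)).to₂

lemma Primrec.powMul {n X Y : α → ℕ} {mul : α → ℕ → ℕ → ℕ} (hn : Primrec n) (hmul : Primrec₃ mul)
    (hX : Primrec X) (hY : Primrec Y) : Primrec fun a => powMul (n a) (mul a) (X a) (Y a) := by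
  refine Primrec.bitSet hn (Primrec.list_any (Primrec.list_range.comp (hn.comp Primrec.fst))
    (Primrec.list_any (Primrec.list_range.comp (hn.comp (Primrec.fst.comp Primrec.fst))) ?_))
  have h1 : Primrec fun q : ((α × ℕ) × ℕ) × ℕ => q.1.1.1 :=
    Primrec.fst.comp (Primrec.fst.comp Primrec.fst)
  have h2 : Primrec fun q : ((α × ℕ) × ℕ) × ℕ => q.1.1.2 :=
    Primrec.snd.comp (Primrec.fst.comp Primrec.fst)
  have h3 : Primrec fun q : ((α × ℕ) × ℕ) × ℕ => q.1.2 := Primrec.snd.comp Primrec.fst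
  have h4 : Primrec fun q : ((α × ℕ) × ℕ) × ℕ => q.2 := Primrec.snd
  exact (Primrec.and.comp (Primrec.and.comp (Primrec.nat_testBit.comp (hX.comp h1) h3)
    (Primrec.nat_testBit.comp (hY.comp h1) h4)) (Primrec.beq.comp (hmul.comp h1 h3 h4) h2)).to₂

lemma Primrec.powAcc {n X Y : α → ℕ} {mul : α → ℕ → ℕ → ℕ} {acc : α → ℕ → ℕ → Bool}
    (hn : Primrec n) (hmul : Primrec₃ mul) (hacc : Primrec₃ acc) (hX : Primrec X) (hY : Primrec Y) :
    Primrec fun a => powAcc (n a) (mul a) (acc a) (X a) (Y a) := by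
  refine Primrec.list_any (Primrec.list_range.comp hn)
    (Primrec.list_any (Primrec.list_range.comp (hn.comp Primrec.fst)) ?_)
  have h1 : Primrec fun q : (α × ℕ) × ℕ => q.1.1 := Primrec.fst.comp Primrec.fst
  have h2 : Primrec fun q : (α × ℕ) × ℕ => q.1.2 := Primrec.snd.comp Primrec.fst
  have h3 : Primrec fun q : (α × ℕ) × ℕ => q.2 := Primrec.snd
  exact (Primrec.and.comp (Primrec.and.comp (Primrec.and.comp (Primrec.and.comp
    (Primrec.nat_testBit.comp (hX.comp h1) h2) (Primrec.nat_testBit.comp (hY.comp h1) h3))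
    (Primrec.beq.comp (hmul.comp h1 h2 h3) h2)) (Primrec.beq.comp (hmul.comp h1 h3 h3) h3))
    (hacc.comp h1 h2 h3)).to₂

lemma Primrec.closeSet {n seed : α → ℕ} {mul : α → ℕ → ℕ → ℕ} {z : α → ℕ → Bool}
    (hn : Primrec n) (hmul : Primrec₃ mul) (hz : Primrec₂ z) (hs : Primrec seed) :
    Primrec fun a => closeSet (n a) (mul a) (z a) (seed a) := by
  refine Primrec.bitSet hn (Primrec.list_all (Primrec.list_range.comp (Primrec.nat_pow.comp
    (Primrec.const 2) (hn.comp Primrec.fst))) (Primrec.or.comp (Primrec.not.comp (Primrec.and.comp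
      (Primrec.nat_testBit.comp Primrec.snd (hs.comp (Primrec.fst.comp Primrec.fst)))
      (Primrec.list_all (Primrec.list_range.comp (hn.comp (Primrec.fst.comp Primrec.fst)))
        (Primrec.list_all (Primrec.list_range.comp
          (hn.comp (Primrec.fst.comp (Primrec.fst.comp Primrec.fst)))) ?_))))
      (Primrec.nat_testBit.comp Primrec.snd (Primrec.snd.comp Primrec.fst))))
  have h1 : Primrec fun q : (((α × ℕ) × ℕ) × ℕ) × ℕ => q.1.1.1.1 :=
    Primrec.fst.comp (Primrec.fst.comp (Primrec.fst.comp Primrec.fst))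
  have h2 : Primrec fun q : (((α × ℕ) × ℕ) × ℕ) × ℕ => q.1.1.2 :=
    Primrec.snd.comp (Primrec.fst.comp Primrec.fst)
  have h3 : Primrec fun q : (((α × ℕ) × ℕ) × ℕ) × ℕ => q.1.2 := Primrec.snd.comp Primrec.fst
  have h4 : Primrec fun q : (((α × ℕ) × ℕ) × ℕ) × ℕ => q.2 := Primrec.snd
  exact (Primrec.or.comp (Primrec.not.comp (Primrec.and.comp (hz.comp h1 h3)
    (Primrec.nat_testBit.comp h2 h4))) (Primrec.nat_testBit.comp h2 (hmul.comp h1 h3 h4))).to₂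

lemma Recognizer.primrec_size : Primrec Recognizer.size := Primrec.fst

lemma Recognizer.primrec_mul : Primrec₃ Recognizer.mul :=
  (Primrec.list_getD 0).comp (Primrec.fst.comp (Primrec.snd.comp Primrec.fst))
    (Primrec₂.natPair.comp (Primrec.fst.comp Primrec.snd) (Primrec.snd.comp Primrec.snd))

lemma Recognizer.primrec_acc : Primrec₃ Recognizer.acc :=
  (Primrec.list_getD false).comp
    (Primrec.fst.comp (Primrec.snd.comp (Primrec.snd.comp Primrec.fst)))
    (Primrec₂.natPair.comp (Primrec.fst.comp Primrec.snd) (Primrec.snd.comp Primrec.snd))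

lemma Recognizer.primrec_letter : Primrec₂ Recognizer.letter :=
  (Primrec.list_getD 0).comp (Primrec.snd.comp (Primrec.snd.comp (Primrec.snd.comp Primrec.fst)))
    Primrec.snd

lemma Recognizer.primrec_mk {n l : α → ℕ} {mul : α → ℕ → ℕ → ℕ} {acc : α → ℕ → ℕ → Bool}
    {letter : α → ℕ → ℕ} (hn : Primrec n) (hmul : Primrec₃ mul) (hacc : Primrec₃ acc)
    (hl : Primrec l) (hletter : Primrec₂ letter) :
    Primrec fun a => Recognizer.mk (n a) (mul a) (acc a) (l a) (letter a) := by
  have h : Primrec fun a => List.range (Nat.pair (n a) (n a)) :=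
    Primrec.list_range.comp (Primrec₂.natPair.comp hn hn)
  have h1 : Primrec fun q : α × ℕ => q.2.unpair.1 :=
    Primrec.fst.comp (Primrec.unpair.comp Primrec.snd)
  have h2 : Primrec fun q : α × ℕ => q.2.unpair.2 :=
    Primrec.snd.comp (Primrec.unpair.comp Primrec.snd)
  exact hn.pair ((Primrec.list_map h (hmul.comp Primrec.fst h1 h2).to₂).pair
    ((Primrec.list_map h (hacc.comp Primrec.fst h1 h2).to₂).pair
      (Primrec.list_map (Primrec.list_range.comp hl) hletter)))

lemma primrec_letters {m : α → ℕ} (hm : Primrec m) : Primrec fun a => 2 ^ m a + 1 :=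
  Primrec.succ.comp (Primrec.nat_pow.comp (Primrec.const 2) hm)

lemma primrec_falseRec : Primrec falseRec :=
  Recognizer.primrec_mk (Primrec.const 1) (Primrec.const 0) (Primrec.const false)
    (primrec_letters Primrec.id) (Primrec₂.const 0)

lemma primrec_impRec : Primrec₃ impRec := by
  have hm : Primrec fun q : ℕ × Recognizer × Recognizer => q.1 := Primrec.fst
  have hr : Primrec fun q : ℕ × Recognizer × Recognizer => q.2.1 := Primrec.fst.comp Primrec.snd
  have hs : Primrec fun q : ℕ × Recognizer × Recognizer => q.2.2 := Primrec.snd.comp Primrec.snd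
  have hx : Primrec fun q : (ℕ × Recognizer × Recognizer) × ℕ × ℕ => q.2.1.unpair :=
    Primrec.unpair.comp (Primrec.fst.comp Primrec.snd)
  have hy : Primrec fun q : (ℕ × Recognizer × Recognizer) × ℕ × ℕ => q.2.2.unpair :=
    Primrec.unpair.comp (Primrec.snd.comp Primrec.snd)
  have hr' := hr.comp (Primrec.fst (α := ℕ × Recognizer × Recognizer) (β := ℕ × ℕ))
  have hs' := hs.comp (Primrec.fst (α := ℕ × Recognizer × Recognizer) (β := ℕ × ℕ))
  unfold Primrec₃ impRec
  exact Recognizer.primrec_mk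
    (Primrec₂.natPair.comp (Recognizer.primrec_size.comp hr) (Recognizer.primrec_size.comp hs))
    (Primrec₂.natPair.comp
      (Recognizer.primrec_mul.comp hr' (Primrec.fst.comp hx) (Primrec.fst.comp hy))
      (Recognizer.primrec_mul.comp hs' (Primrec.snd.comp hx) (Primrec.snd.comp hy)))
    (Primrec.or.comp (Primrec.not.comp
      (Recognizer.primrec_acc.comp hr' (Primrec.fst.comp hx) (Primrec.fst.comp hy)))
      (Recognizer.primrec_acc.comp hs' (Primrec.snd.comp hx) (Primrec.snd.comp hy)))
    (primrec_letters hm)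
    (Primrec₂.natPair.comp
      (Recognizer.primrec_letter.comp (hr.comp Primrec.fst) Primrec.snd)
      (Recognizer.primrec_letter.comp (hs.comp Primrec.fst) Primrec.snd)).to₂

lemma primrec_allRec : Primrec₂ allRec := by
  have hm : Primrec fun q : ℕ × Recognizer => q.1 := Primrec.fst
  have hr : Primrec fun q : ℕ × Recognizer => q.2 := Primrec.snd
  have hsz : Primrec fun q : ℕ × Recognizer => q.2.size := Recognizer.primrec_size.comp hr
  have hmul : Primrec₃ fun q : ℕ × Recognizer => q.2.mul :=
    Recognizer.primrec_mul.comp (hr.comp Primrec.fst) (Primrec.fst.comp Primrec.snd)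
      (Primrec.snd.comp Primrec.snd)
  have hacc : Primrec₃ fun (q : ℕ × Recognizer) a b => !q.2.acc a b :=
    Primrec.not.comp (Recognizer.primrec_acc.comp (hr.comp Primrec.fst)
      (Primrec.fst.comp Primrec.snd) (Primrec.snd.comp Primrec.snd))
  have hpow : Primrec fun q : ℕ × Recognizer => 2 ^ q.1 :=
    Primrec.nat_pow.comp (Primrec.const 2) hm
  refine Recognizer.primrec_mk (Primrec.nat_pow.comp (Primrec.const 2) hsz)
    (Primrec.powMul (hsz.comp Primrec.fst)
      (hmul.comp (Primrec.fst.comp Primrec.fst) (Primrec.fst.comp Primrec.snd)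
        (Primrec.snd.comp Primrec.snd)) (Primrec.fst.comp Primrec.snd)
      (Primrec.snd.comp Primrec.snd))
    (Primrec.not.comp (Primrec.powAcc (hsz.comp Primrec.fst)
      (hmul.comp (Primrec.fst.comp Primrec.fst) (Primrec.fst.comp Primrec.snd)
        (Primrec.snd.comp Primrec.snd))
      (hacc.comp (Primrec.fst.comp Primrec.fst) (Primrec.fst.comp Primrec.snd)
        (Primrec.snd.comp Primrec.snd)) (Primrec.fst.comp Primrec.snd)
      (Primrec.snd.comp Primrec.snd)))
    (primrec_letters hm) (Primrec.ite ?_ ?_ ?_)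
  · exact Primrec.eq.comp Primrec.snd (Primrec.const 0)
  · exact Primrec.closeSet (hsz.comp Primrec.fst) (hmul.comp (Primrec.fst.comp Primrec.fst)
      (Primrec.fst.comp Primrec.snd) (Primrec.snd.comp Primrec.snd))
      (Primrec.or.comp
        (Primrec.beq.comp Primrec.snd (Recognizer.primrec_letter.comp
          (hr.comp (Primrec.fst.comp Primrec.fst)) (Primrec.const 1)))
        (Primrec.beq.comp Primrec.snd (Recognizer.primrec_letter.comp
          (hr.comp (Primrec.fst.comp Primrec.fst))
          (Primrec.succ.comp (hpow.comp (Primrec.fst.comp Primrec.fst)))))).to₂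
      (Recognizer.primrec_letter.comp (hr.comp Primrec.fst) (Primrec.const 0))
  · exact Primrec.bitSet (hsz.comp Primrec.fst) (Primrec.or.comp
      (Primrec.beq.comp Primrec.snd (Recognizer.primrec_letter.comp
        (hr.comp (Primrec.fst.comp Primrec.fst)) (Primrec.snd.comp Primrec.fst)))
      (Primrec.beq.comp Primrec.snd (Recognizer.primrec_letter.comp
        (hr.comp (Primrec.fst.comp Primrec.fst))
        (Primrec.nat_add.comp (Primrec.snd.comp Primrec.fst)
          (hpow.comp (Primrec.fst.comp Primrec.fst)))))).to₂

lemma primrec_acceptsHashes : Primrec acceptsHashes := by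
  have hmul : Primrec₃ fun r : Recognizer => r.mul := Recognizer.primrec_mul
  have hl : Primrec fun r : Recognizer => r.letter 0 :=
    Recognizer.primrec_letter.comp Primrec.id (Primrec.const 0)
  have hc := Primrec.closeSet Recognizer.primrec_size hmul (z := fun r a => a == r.letter 0)
    (Primrec.beq.comp Primrec.snd (hl.comp Primrec.fst)).to₂ hl
  exact Primrec.powAcc Recognizer.primrec_size hmul Recognizer.primrec_acc hc hc

lemma primrec_pathStart : Primrec pathStart :=
  Primrec.fst.comp (Primrec.unpair.comp Primrec.pred)

lemma primrec_pathFlag : Primrec pathFlag :=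
  Primrec.fst.comp (Primrec.unpair.comp (Primrec.snd.comp (Primrec.unpair.comp Primrec.pred)))

lemma primrec_pathEnd : Primrec pathEnd :=
  Primrec.snd.comp (Primrec.unpair.comp (Primrec.snd.comp (Primrec.unpair.comp Primrec.pred)))

lemma primrec_pathCode : Primrec₃ pathCode :=
  Primrec.succ.comp (Primrec₂.natPair.comp Primrec.fst (Primrec₂.natPair.comp
    (Primrec.fst.comp Primrec.snd) (Primrec.snd.comp Primrec.snd)))

lemma primrec_pathMul : Primrec₂ pathMul :=
  Primrec.ite
    ((Primrec.eq.comp Primrec.fst (Primrec.const 0)).or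
      ((Primrec.eq.comp Primrec.snd (Primrec.const 0)).or
        (Primrec.eq.comp (primrec_pathEnd.comp Primrec.fst)
          (primrec_pathStart.comp Primrec.snd)).not))
    (Primrec.const 0)
    (primrec_pathCode.comp (primrec_pathStart.comp Primrec.fst)
      (Primrec.nat_max.comp (primrec_pathFlag.comp Primrec.fst) (primrec_pathFlag.comp Primrec.snd))
      (primrec_pathEnd.comp Primrec.snd))

lemma primrec_pathBound : Primrec pathBound :=
  Primrec.succ.comp (Primrec₂.natPair.comp Primrec.succ
    (Primrec₂.natPair.comp (Primrec.const 2) Primrec.succ))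

lemma Primrec.runAcc {ini : α → ℕ → Bool} (h : Primrec₂ ini) : Primrec₃ fun a => runAcc (ini a) := by
  have hs : Primrec fun q : α × ℕ × ℕ => q.2.1 := Primrec.fst.comp Primrec.snd
  have he : Primrec fun q : α × ℕ × ℕ => q.2.2 := Primrec.snd.comp Primrec.snd
  exact Primrec.and.comp (Primrec.and.comp (Primrec.and.comp
    (Primrec.not.comp (Primrec.beq.comp hs (Primrec.const 0)))
    (Primrec.not.comp (Primrec.beq.comp he (Primrec.const 0))))
    (h.comp Primrec.fst (primrec_pathStart.comp hs)))
    (Primrec.beq.comp (primrec_pathFlag.comp he) (Primrec.const 1))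

lemma primrec_trackLetter : Primrec₂ trackLetter :=
  Primrec.ite (Primrec.eq.comp Primrec.fst (Primrec.const 0)) (Primrec.const none)
    (Primrec.option_some.comp
      (Primrec.nat_testBit.comp (Primrec.pred.comp Primrec.fst) Primrec.snd))

/-- For an arbitrary lawful `==`, so that it applies to lists of symbols. -/
lemma Primrec.beq_of_lawful {α : Type*} [Primcodable α] [DecidableEq α] [BEq α] [LawfulBEq α] :
    Primrec₂ fun a b : α => a == b :=
  (Primrec.eq (α := α)).decide.of_eq fun a b => by
    rw [Bool.eq_iff_iff, beq_iff_eq, decide_eq_true_iff]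

/-- The initial states after the letter `#` in front. -/
def atomInit (q : AutomatonData × List ℕ × ℕ) (s : ℕ) : Bool :=
  q.1.2.1.any fun t => t.2.2 == s && t.2.1 == q.2.1.map (fun _ => (none : HashSym)) &&
    q.1.2.2.1.any fun p => p == t.1

lemma primrec_atomInit : Primrec₂ atomInit := by
  have hL : Primrec fun q : ((AutomatonData × List ℕ × ℕ) × ℕ) × ℕ × List HashSym × ℕ =>
      q.1.1.2.1.map fun _ => (none : HashSym) :=
    Primrec.list_map (Primrec.fst.comp (Primrec.snd.comp (Primrec.fst.comp Primrec.fst)))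
      (Primrec₂.const none)
  have hI : Primrec fun q : ((AutomatonData × List ℕ × ℕ) × ℕ) × ℕ × List HashSym × ℕ =>
      q.1.1.1.2.2.1.any fun p => p == q.2.1 :=
    Primrec.list_any (Primrec.fst.comp (Primrec.snd.comp (Primrec.snd.comp
      (Primrec.fst.comp (Primrec.fst.comp Primrec.fst)))))
      (Primrec.beq.comp Primrec.snd (Primrec.fst.comp (Primrec.snd.comp Primrec.fst))).to₂
  have h1 : Primrec fun q : ((AutomatonData × List ℕ × ℕ) × ℕ) × ℕ × List HashSym × ℕ =>
      q.2.2.2 == q.1.2 :=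
    Primrec.beq.comp (Primrec.snd.comp (Primrec.snd.comp Primrec.snd))
      (Primrec.snd.comp Primrec.fst)
  have h2 : Primrec fun q : ((AutomatonData × List ℕ × ℕ) × ℕ) × ℕ × List HashSym × ℕ =>
      q.2.2.1 == q.1.1.2.1.map fun _ => (none : HashSym) :=
    Primrec.beq_of_lawful.comp (Primrec.fst.comp (Primrec.snd.comp Primrec.snd)) hL
  exact Primrec.list_any (Primrec.fst.comp (Primrec.snd.comp (Primrec.fst.comp Primrec.fst)))
    (Primrec.and.comp (Primrec.and.comp h1 h2) hI).to₂

/-- The sets of transitions for the letters. -/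
def atomLetter (q : AutomatonData × List ℕ × ℕ) (c : ℕ) : ℕ :=
  bitSet (pathBound q.1.1) fun d => q.1.2.1.any fun t => t.2.1 == q.2.1.map (trackLetter c) &&
    d == pathCode t.1 (q.1.2.2.2.any fun s => s == t.2.2).toNat t.2.2

lemma primrec_atomLetter : Primrec₂ atomLetter := by
  have hT : Primrec fun q : (((AutomatonData × List ℕ × ℕ) × ℕ) × ℕ) × ℕ × List HashSym × ℕ =>
      q.1.1 := Primrec.fst.comp Primrec.fst
  have hL : Primrec fun q : (((AutomatonData × List ℕ × ℕ) × ℕ) × ℕ) × ℕ × List HashSym × ℕ =>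
      q.1.1.1.2.1.map (trackLetter q.1.1.2) :=
    Primrec.list_map (Primrec.fst.comp (Primrec.snd.comp (Primrec.fst.comp hT)))
      (primrec_trackLetter.comp ((Primrec.snd.comp hT).comp Primrec.fst) Primrec.snd).to₂
  have hA : Primrec fun q : (((AutomatonData × List ℕ × ℕ) × ℕ) × ℕ) × ℕ × List HashSym × ℕ =>
      q.1.1.1.1.2.2.2.any fun s => s == q.2.2.2 :=
    Primrec.list_any (Primrec.snd.comp (Primrec.snd.comp (Primrec.snd.comp
      (Primrec.fst.comp (Primrec.fst.comp hT)))))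
      (Primrec.beq.comp Primrec.snd
        (Primrec.snd.comp (Primrec.snd.comp (Primrec.snd.comp Primrec.fst)))).to₂
  have hC : Primrec fun q : (((AutomatonData × List ℕ × ℕ) × ℕ) × ℕ) × ℕ × List HashSym × ℕ =>
      pathCode q.2.1 (q.1.1.1.1.2.2.2.any fun s => s == q.2.2.2).toNat q.2.2.2 :=
    primrec_pathCode.comp (Primrec.fst.comp Primrec.snd) (Primrec.bool_toNat.comp hA)
      (Primrec.snd.comp (Primrec.snd.comp Primrec.snd))
  have h1 : Primrec fun q : (((AutomatonData × List ℕ × ℕ) × ℕ) × ℕ) × ℕ × List HashSym × ℕ =>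
      q.2.2.1 == q.1.1.1.2.1.map (trackLetter q.1.1.2) :=
    Primrec.beq_of_lawful.comp (Primrec.fst.comp (Primrec.snd.comp Primrec.snd)) hL
  have h2 : Primrec fun q : (((AutomatonData × List ℕ × ℕ) × ℕ) × ℕ) × ℕ × List HashSym × ℕ =>
      q.1.2 == pathCode q.2.1 (q.1.1.1.1.2.2.2.any fun s => s == q.2.2.2).toNat q.2.2.2 :=
    Primrec.beq.comp (Primrec.snd.comp Primrec.fst) hC
  exact Primrec.bitSet
    (primrec_pathBound.comp (Primrec.fst.comp (Primrec.fst.comp Primrec.fst)))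
    (Primrec.list_any (Primrec.fst.comp (Primrec.snd.comp (Primrec.fst.comp
      (Primrec.fst.comp Primrec.fst)))) (Primrec.and.comp h1 h2).to₂).to₂

lemma primrec_atomRec : Primrec₃ atomRec := by
  have hN : Primrec fun q : AutomatonData × List ℕ × ℕ => pathBound q.1.1 :=
    primrec_pathBound.comp (Primrec.fst.comp Primrec.fst)
  have hm : Primrec fun q : AutomatonData × List ℕ × ℕ => q.2.2 := Primrec.snd.comp Primrec.snd
  have hmul : Primrec₃ fun (_ : (AutomatonData × List ℕ × ℕ) × ℕ × ℕ) => pathMul :=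
    primrec_pathMul.comp (Primrec.fst.comp Primrec.snd) (Primrec.snd.comp Primrec.snd)
  have hx : Primrec fun q : (AutomatonData × List ℕ × ℕ) × ℕ × ℕ => q.2.1 := Primrec.fst.comp Primrec.snd
  have hy : Primrec fun q : (AutomatonData × List ℕ × ℕ) × ℕ × ℕ => q.2.2 := Primrec.snd.comp Primrec.snd
  have hini : Primrec₂ fun q : (AutomatonData × List ℕ × ℕ) × ℕ × ℕ => atomInit q.1 :=
    primrec_atomInit.comp (Primrec.fst.comp Primrec.fst) Primrec.snd
  exact Recognizer.primrec_mk (Primrec.nat_pow.comp (Primrec.const 2) hN)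
    (Primrec.powMul (hN.comp Primrec.fst) hmul hx hy)
    (Primrec.powAcc (hN.comp Primrec.fst) hmul
      (Primrec.runAcc hini) hx hy)
    (primrec_letters hm) primrec_atomLetter

lemma primrec_evalStep : Primrec₃ evalStep := by
  let T := (List (ℕ × AutomatonData) × ℕ × List (List Recognizer)) × ℕ
  have hauts : Primrec fun q : T => q.1.1 := Primrec.fst.comp Primrec.fst
  have hprev : Primrec fun q : T => q.1.2.2 := Primrec.snd.comp (Primrec.snd.comp Primrec.fst)
  have hm : Primrec fun q : T => q.2 := Primrec.snd
  have hu : Primrec fun q : T => q.1.2.2.length.unpair :=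
    Primrec.unpair.comp (Primrec.list_length.comp hprev)
  have hk := Primrec.fst.comp hu
  have hd := Primrec.snd.comp hu
  have hd1 := Primrec.fst.comp (Primrec.unpair.comp hd)
  have hd2 := Primrec.snd.comp (Primrec.unpair.comp hd)
  have hget : ∀ {i j : T → ℕ}, Primrec i → Primrec j → Primrec fun q : T =>
      (q.1.2.2.getD (i q) []).getD (j q) (0, [], [], []) := fun hi hj =>
    (Primrec.list_getD _).comp ((Primrec.list_getD _).comp hprev hi) hj
  have hsm := Primrec.succ.comp hm
  refine Primrec.list_map (Primrec.list_range.comp (Primrec.fst.comp Primrec.snd)) (Primrec.ite ?_ ?_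
    (Primrec.ite ?_ ?_ (Primrec.ite ?_ ?_ (Primrec.ite ?_ ?_ ?_))))
  · exact Primrec.eq.comp hk (Primrec.const 1)
  · exact primrec_atomRec.comp (Primrec.const _)
      (Primrec.list_cons.comp hd1 (Primrec.list_cons.comp hd2 (Primrec.const []))) hm
  · exact Primrec.eq.comp hk (Primrec.const 2)
  · exact primrec_atomRec.comp (Primrec.snd.comp ((Primrec.list_getD _).comp hauts hd1))
      (Primrec.option_getD.comp (Primrec.decode.comp hd2) (Primrec.const [])) hm
  · exact Primrec.eq.comp hk (Primrec.const 3)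
  · exact primrec_impRec.comp hm (hget hd1 hm) (hget hd2 hm)
  · exact Primrec.eq.comp hk (Primrec.const 4)
  · exact primrec_allRec.comp hm (primrec_impRec.comp hsm
      (primrec_atomRec.comp (Primrec.const _) (Primrec.list_cons.comp hm (Primrec.const [])) hsm)
      (hget hd hsm))
  · exact primrec_falseRec.comp hm

/-- Keeping the whole table as the recursive value makes this an ordinary primitive recursion. -/
lemma primrec_evalTable : Primrec₃ evalTable := by
  have hstep : Primrec fun q : (List (ℕ × AutomatonData) × ℕ × ℕ) × ℕ × List (List Recognizer) =>
      q.2.2 ++ [evalStep q.1.1 q.1.2.1 q.2.2] :=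
    Primrec.list_concat.comp (Primrec.snd.comp Primrec.snd)
      (primrec_evalStep.comp (Primrec.fst.comp Primrec.fst)
        (Primrec.fst.comp (Primrec.snd.comp Primrec.fst)) (Primrec.snd.comp Primrec.snd))
  refine (Primrec.nat_rec' (f := fun q : List (ℕ × AutomatonData) × ℕ × ℕ => q.2.2)
    (Primrec.snd.comp Primrec.snd) (Primrec.const []) hstep.to₂).of_eq fun q => ?_
  induction q.2.2 with
  | zero => rfl
  | succ n ih => rw [evalTable, ← ih]

theorem primrec_decideTheory : Primrec₂ decideTheory := by
  have hB : Primrec fun q : List (ℕ × AutomatonData) × ℕ => q.2 + 1 :=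
    Primrec.succ.comp Primrec.snd
  exact primrec_acceptsHashes.comp ((Primrec.list_getD _).comp
    (primrec_evalStep.comp Primrec.fst hB (primrec_evalTable.comp Primrec.fst hB Primrec.snd))
    (Primrec.const 0))

end Primrec

theorem mainTheorem7 :
    -- the theory of `(Irr; X₁, …, Xₙ)` is decidable
    (∀ (n : ℕ) (ar : Fin n → ℕ) (X : ∀ i, Set (Fin (ar i) → Irr))
      (A : ∀ i, BuchiAutomaton (Fin (ar i) → HashSym)), (∀ i, RecognizableBy (X i) (A i)) →
      HasDecidableTheory ar (IrrStructure X)) ∧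
    -- and one algorithm does this for all given automata
    (∃ f : List (ℕ × AutomatonData) → ℕ → Bool, Computable₂ f ∧
      ∀ (n : ℕ) (ar : Fin n → ℕ) (X : ∀ i, Set (Fin (ar i) → Irr))
        (A : ∀ i, BuchiAutomaton (Fin (ar i) → HashSym)), (∀ i, RecognizableBy (X i) (A i)) →
        ∀ φ : (relLang ar).Sentence,
          f (List.ofFn fun i => (ar i, (A i).data)) (godelNumber φ) = true ↔
            FirstOrder.Language.Sentence.Realize (IrrStructure X) φ) :=
  ⟨fun _ ar _ A hA => ⟨decideTheory (List.ofFn fun i => (ar i, (A i).data)),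
      (primrec_decideTheory.comp (Primrec.const _) Primrec.id).to_comp,
      fun φ => decideTheory_iff hA φ⟩,
    decideTheory, primrec_decideTheory.to_comp, fun _ _ _ _ hA φ => decideTheory_iff hA φ⟩
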